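/- Let $\mathcal V_D$ (datatype variables $\alpha,\beta,\dots$), $\mathcal V_A$ (type variables $X,Y,\dots$) be disjoint countably infinite sets and $\mathcal C$ a set of type constants $c,d,\dots$; put $\mathcal V=\mathcal V_D\cup\mathcal V_A$. The $\mu$-datatypes $D$ and $\mu$-types $A$, taken up to renaming of bound variables, are given by the grammars $$D ::= \alpha \mid c \mid D \mathbin{@} A \mid D\oplus D \mid \mu\alpha.D, \qquad A ::= X \mid D \mid A\supset A \mid A\oplus A \mid \mu X.A ,$$ where only contractive expressions are considered: in every subexpression $\mu V.A$ the variable $V$ occurs in $A$ only under a constructor $\supset$ or $@$, if at all. **Equivalence of $\mu$-types.** $\simeq_\mu$ is the least equivalence relation on contractive $\mu$-types that is a congruence for $@$, $\supset$, $\oplus$ and $\mu V.(\cdot)$, satisfies $A\oplus A\simeq_\mu A$, $A\oplus B\simeq_\mu B\oplus A$, $A\oplus(B\oplus C)\simeq_\mu(A\oplus B)\oplus C$ and $\mu V.A\simeq_\mu \{V:=\mu V.A\}A$, and is closed under the rule: if $\mu V.B$ is contractive and $A\simeq_\mu\{V:=A\}B$, then $A\simeq_\mu\mu V.B$. All expressions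 in a rule are required to respect the two sorts (so if $V$ is a datatype variable, then in the last rule $A$ and $B$ are $\mu$-datatypes). Substitution is capture-avoiding. **Trees.** Let $\mathfrak T$ be the set of possibly infinite trees over the symbols $a\in\mathcal V\cup\mathcal C$ (arity $0$) and $@,\supset,\oplus$ (arity $2$) that have no infinite branch which from some point on consists of $\oplus$ only. Let $\mathfrak T^{\mathfrak n}$ be the set of possibly infinite trees over the symbols $a\in\mathcal V\cup\mathcal C$ (arity $0$), $@,\supset$ (arity $2$) and $\oplus^n$ (arity $n$) for each $n>1$. The unfolding $[\![A]\!]\in\mathfrak T$ of a contractive $\mu$-type $A$ is determined by $[\![a]\!]=a$, $[\![A_1\star A_2]\!]=[\![A_1]\!]\star[\![A_2]\!]$ for $\star\in\{@,\supset,\oplus\}$, and $[\![\mu V.A]\!]=[\![\{V:=\mu V.A\}A]\!]$. The translation $[\![\cdot]\!]^{\mathfrak n}:\mathfrak T\to\mathfrak T^{\mathfrak n}$ is determined by $[\![a]\!]^{\mathfrak n}=a$, $[\![T_1\star T_2]\!]^{\mathfrak n}=[\![T_1]\!]^{\mathfrak n}\star[\![T_2]\!]^{\mathfrak n}$ for $\star\in\{@,\supset\}$,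 and $[\![T_1\oplus\cdots\oplus T_n]\!]^{\mathfrak n}=\oplus^n([\![T_1]\!]^{\mathfrak n},\dots,[\![T_n]\!]^{\mathfrak n})$ for $n>1$ whenever no $T_i$ has root $\oplus$ (irrespective of how the binary unions are associated). **Equivalence up to $\mathcal R$.** For a relation $\mathcal R$ on $\mathfrak T^{\mathfrak n}$, let $\simeq_{\mathcal R}$ be the relation on $\mathfrak T^{\mathfrak n}$ defined coinductively, that is, as the largest relation such that each of its pairs is the conclusion of one of the following rules, where $\approx$ stands for $\simeq_{\mathcal R}\cup\mathcal R$, where $n,m>1$, and where in the last three rules $S_i$, $T_j$, $S$, $T$ do not have a union at the root: 1. $a\simeq_{\mathcal R}a$ for $a\in\mathcal V\cup\mathcal C$; 2. $S\mathbin{@}T\simeq_{\mathcal R}S'\mathbin{@}T'$ if $S\approx S'$ and $T\approx T'$; 3. $S\supset T\simeq_{\mathcal R}S'\supset T'$ if $S'\approx S$ and $T\approx T'$; 4. $\oplus^n(S_1,\dots,S_n)\simeq_{\mathcal R}\oplus^m(T_1,\dots,T_m)$ if there are $f:\{1,\dots,n\}\to\{1,\dots,m\}$ and $g:\{1,\dots,m\}\to\{1,\dots,n\}$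 with $S_i\approx T_{f(i)}$ for all $i$ and $S_{g(j)}\approx T_j$ for all $j$; 5. $\oplus^n(S_1,\dots,S_n)\simeq_{\mathcal R}T$ if $S_i\approx T$ for all $i$; 6. $S\simeq_{\mathcal R}\oplus^m(T_1,\dots,T_m)$ if $S\approx T_j$ for all $j$. **Proposition.** For all contractive $\mu$-types $A$ and $B$, $$A\simeq_\mu B\quad\Longleftrightarrow\quad [\![[\![A]\!]]\!]^{\mathfrak n}\;\simeq_\varnothing\;[\![[\![B]\!]]\!]^{\mathfrak n}.$$ -/

import Mathlib

namespace CAP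

universe u

/-! ## Raw type expressions -/

/-- The two sorts of type expressions (and of type variables): datatypes and types. -/
inductive Srt where
  | data
  | type
  deriving DecidableEq

/-- Raw type expressions over the type constants `C`, up to renaming of bound variables (de Bruijn
indices).  The two sorts of variables are indexed independently of each other: `mu s A` binds the
variable `var s 0` of `A`, and below it the free variable `var s n` is written `var s (n + 1)`,
while variables of the other sort keep their index.  Hence the free datatype variables are
`var .data 0, var .data 1, …` and the free type variables are `var .type 0, var .type 1, …`. -/
inductive Ty (C : Type u) : Type u where
  | var (s : Srt) (n : ℕ)
  | const (c : C)
  | app (D A : Ty C)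
  | fn (A B : Ty C)
  | union (A B : Ty C)
  | mu (s : Srt) (A : Ty C)

namespace Ty

variable {C : Type u}

/-- Lifting of a renaming below a binder of sort `s`. -/
def upRen (s : Srt) (ρ : Srt → ℕ → ℕ) (s' : Srt) (n : ℕ) : ℕ :=
  if s' = s then
    match n with
    | 0 => 0
    | n + 1 => ρ s' n + 1
  else ρ s' n

/-- Simultaneous renaming of the free variables. -/
def rename : (Srt → ℕ → ℕ) → Ty C → Ty C
  | ρ, var s n => var s (ρ s n)
  | _, const c => const c
  | ρ, app D A => app (rename ρ D) (rename ρ A)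
  | ρ, fn A B => fn (rename ρ A) (rename ρ B)
  | ρ, union A B => union (rename ρ A) (rename ρ B)
  | ρ, mu s A => mu s (rename (upRen s ρ) A)

/-- Weakening by one variable of sort `s`. -/
def shift (s : Srt) (A : Ty C) : Ty C :=
  rename (fun s' n => if s' = s then n + 1 else n) A

/-- Lifting of a substitution below a binder of sort `s`. -/
def up (s : Srt) (σ : Srt → ℕ → Ty C) (s' : Srt) (n : ℕ) : Ty C :=
  if s' = s then
    match n with
    | 0 => var s' 0
    | n + 1 => shift s (σ s' n)
  else shift s (σ s' n)

/-- Simultaneous capture-avoiding substitution for the free variables. -/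
def subst : (Srt → ℕ → Ty C) → Ty C → Ty C
  | σ, var s n => σ s n
  | _, const c => const c
  | σ, app D A => app (subst σ D) (subst σ A)
  | σ, fn A B => fn (subst σ A) (subst σ B)
  | σ, union A B => union (subst σ A) (subst σ B)
  | σ, mu s A => mu s (subst (up s σ) A)

/-- The substitution that sends `var s 0` to `B` and removes this variable from the scope. -/
def single (s : Srt) (B : Ty C) (s' : Srt) (n : ℕ) : Ty C :=
  if s' = s then
    match n with
    | 0 => B
    | n + 1 => var s' n
  else var s' n

/-- `inst s B A` is `{V := B} A` for the variable `V` bound in `mu s A`. -/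
def inst (s : Srt) (B A : Ty C) : Ty C := subst (single s B) A

/-- The two-sorted grammar: `HasSort .data D` means that `D` is a `μ`-datatype, and
`HasSort .type A` that `A` is a `μ`-type. -/
inductive HasSort : Srt → Ty C → Prop where
  | var (s : Srt) (n : ℕ) : HasSort s (var s n)
  | const (c : C) : HasSort .data (const c)
  | app {D A : Ty C} : HasSort .data D → HasSort .type A → HasSort .data (app D A)
  | fn {A B : Ty C} : HasSort .type A → HasSort .type B → HasSort .type (fn A B)
  | union {s : Srt} {A B : Ty C} : HasSort s A → HasSort s B → HasSort s (union A B)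
  | mu {s : Srt} {A : Ty C} : HasSort s A → HasSort s (mu s A)
  | incl {D : Ty C} : HasSort .data D → HasSort .type D

/-- The free variable `var s k` has an occurrence in the expression which is not under one of the
type constructors `app`, `fn`. -/
def Unguarded (s : Srt) : ℕ → Ty C → Prop
  | k, var s' n => s' = s ∧ n = k
  | _, const _ => False
  | _, app _ _ => False
  | _, fn _ _ => False
  | k, union A B => Unguarded s k A ∨ Unguarded s k B
  | k, mu s' A => Unguarded s (if s' = s then k + 1 else k) A

/-- Every subexpression `mu s A` is contractive: its bound variable occurs in `A` only under the
type constructors `app`, `fn`, if at all. -/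
def Contractive : Ty C → Prop
  | var _ _ => True
  | const _ => True
  | app D A => Contractive D ∧ Contractive A
  | fn A B => Contractive A ∧ Contractive B
  | union A B => Contractive A ∧ Contractive B
  | mu s A => ¬ Unguarded s 0 A ∧ Contractive A

/-- `A` is a contractive `μ`-type. -/
def WF (A : Ty C) : Prop := HasSort .type A ∧ Contractive A

/-- The height of the `μ⊕`-context at the root of an expression. -/
def height : Ty C → ℕ
  | var _ _ => 0
  | const _ => 0
  | app _ _ => 0
  | fn _ _ => 0
  | union A B => max (height A) (height B) + 1
  | mu _ A => height A + 1

/-! Unfolding a contractive `μ`-type gives a contractive `μ`-type and makes the height smaller. -/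

theorem height_rename (A : Ty C) : ∀ ρ, height (rename ρ A) = height A := by
  induction A <;> intro ρ <;> simp_all [rename, height]

theorem height_subst (A : Ty C) : ∀ σ : Srt → ℕ → Ty C,
    (∀ s n, Unguarded s n A → height (σ s n) = 0) → height (subst σ A) = height A := by
  induction A with
  | var s n => intro σ h; simpa [subst, height] using h s n ⟨rfl, rfl⟩
  | const c => intro σ h; rfl
  | app D A _ _ => intro σ h; rfl
  | fn A B _ _ => intro σ h; rfl
  | union A B ihA ihB =>
    intro σ h
    simp only [subst, height]
    rw [ihA σ fun s n hs => h s n (Or.inl hs), ihB σ fun s n hs => h s n (Or.inr hs)]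
  | mu t A ih =>
    intro σ h
    simp only [subst, height]
    rw [ih]
    intro s n hs
    by_cases hst : s = t
    · subst hst
      cases n with
      | zero => simp [up, height]
      | succ n =>
        simp only [up, if_true, shift, height_rename]
        exact h s n (by simpa [Unguarded] using hs)
    · simp only [up, if_neg hst, shift, height_rename]
      exact h s n (by simpa [Unguarded, Ne.symm hst] using hs)

theorem height_inst {s : Srt} {A : Ty C} (h : ¬ Unguarded s 0 A) (B : Ty C) :
    height (inst s B A) = height A := by
  refine height_subst A _ fun s' n hs => ?_
  by_cases hss : s' = s
  · subst hss
    cases n with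
    | zero => exact absurd hs h
    | succ n => simp [single, height]
  · simp [single, hss, height]

theorem unguarded_rename {s : Srt} (A : Ty C) : ∀ (ρ : Srt → ℕ → ℕ) (k : ℕ),
    Unguarded s k (rename ρ A) → ∃ n, ρ s n = k ∧ Unguarded s n A := by
  induction A with
  | var s' n => rintro ρ k ⟨rfl, hn⟩; exact ⟨n, hn, rfl, rfl⟩
  | const c => intro ρ k h; exact h.elim
  | app D A _ _ => intro ρ k h; exact h.elim
  | fn A B _ _ => intro ρ k h; exact h.elim
  | union A B ihA ihB =>
    rintro ρ k (h | h)
    · obtain ⟨n, h1, h2⟩ := ihA ρ k h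
      exact ⟨n, h1, Or.inl h2⟩
    · obtain ⟨n, h1, h2⟩ := ihB ρ k h
      exact ⟨n, h1, Or.inr h2⟩
  | mu t A ih =>
    intro ρ k h
    obtain ⟨n, h1, h2⟩ := ih _ _ h
    by_cases hts : t = s
    · subst hts
      cases n with
      | zero => simp [upRen] at h1
      | succ n => exact ⟨n, by simpa [upRen] using h1, by simpa [Unguarded] using h2⟩
    · exact ⟨n, by simpa [upRen, hts, Ne.symm hts] using h1, by simpa [Unguarded, hts] using h2⟩

theorem unguarded_subst {s : Srt} (A : Ty C) : ∀ (σ : Srt → ℕ → Ty C) (k : ℕ),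
    Unguarded s k (subst σ A) → ∃ s' n, Unguarded s' n A ∧ Unguarded s k (σ s' n) := by
  induction A with
  | var s' n => intro σ k h; exact ⟨s', n, ⟨rfl, rfl⟩, h⟩
  | const c => intro σ k h; exact h.elim
  | app D A _ _ => intro σ k h; exact h.elim
  | fn A B _ _ => intro σ k h; exact h.elim
  | union A B ihA ihB =>
    rintro σ k (h | h)
    · obtain ⟨s', n, h1, h2⟩ := ihA σ k h
      exact ⟨s', n, Or.inl h1, h2⟩
    · obtain ⟨s', n, h1, h2⟩ := ihB σ k h
      exact ⟨s', n, Or.inr h1, h2⟩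
  | mu t A ih =>
    intro σ k h
    obtain ⟨s', n, h1, h2⟩ := ih _ _ h
    have key : ∀ B : Ty C, Unguarded s (if t = s then k + 1 else k) (shift t B) →
        Unguarded s k B := by
      intro B hB
      obtain ⟨m, h3, h4⟩ := unguarded_rename B _ _ hB
      by_cases hts : t = s
      · subst hts
        simp only [if_true, Nat.add_right_cancel_iff] at h3
        exact h3 ▸ h4
      · simp only [if_neg hts, if_neg (Ne.symm hts)] at h3
        exact h3 ▸ h4
    by_cases hst : s' = t
    · subst hst
      cases n with
      | zero =>
        obtain ⟨rfl, h3⟩ : s' = s ∧ 0 = (if s' = s then k + 1 else k) := by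
          simpa [up, Unguarded] using h2
        simp at h3
      | succ n =>
        exact ⟨s', n, by simpa [Unguarded] using h1, key _ (by simpa [up] using h2)⟩
    · exact ⟨s', n, by simpa [Unguarded, Ne.symm hst] using h1,
        key _ (by simpa [up, hst] using h2)⟩

theorem Contractive.rename {A : Ty C} (h : Contractive A) : ∀ ρ, Contractive (A.rename ρ) := by
  induction A with
  | var s n => intro ρ; trivial
  | const c => intro ρ; trivial
  | app D A ihD ihA => intro ρ; exact ⟨ihD h.1 ρ, ihA h.2 ρ⟩
  | fn A B ihA ihB => intro ρ; exact ⟨ihA h.1 ρ, ihB h.2 ρ⟩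
  | union A B ihA ihB => intro ρ; exact ⟨ihA h.1 ρ, ihB h.2 ρ⟩
  | mu s A ih =>
    refine fun ρ => ⟨fun hu => ?_, ih h.2 _⟩
    obtain ⟨n, h1, h2⟩ := unguarded_rename A _ _ hu
    cases n with
    | zero => exact h.1 h2
    | succ n => simp [upRen] at h1

theorem Contractive.subst {A : Ty C} (h : Contractive A) : ∀ σ : Srt → ℕ → Ty C,
    (∀ s n, Contractive (σ s n)) → Contractive (A.subst σ) := by
  induction A with
  | var s n => intro σ hσ; exact hσ s n
  | const c => intro σ hσ; trivial
  | app D A ihD ihA => intro σ hσ; exact ⟨ihD h.1 σ hσ, ihA h.2 σ hσ⟩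
  | fn A B ihA ihB => intro σ hσ; exact ⟨ihA h.1 σ hσ, ihB h.2 σ hσ⟩
  | union A B ihA ihB => intro σ hσ; exact ⟨ihA h.1 σ hσ, ihB h.2 σ hσ⟩
  | mu s A ih =>
    refine fun σ hσ => ⟨fun hu => ?_, ih h.2 _ fun s' n => ?_⟩
    · obtain ⟨s', n, h1, h2⟩ := unguarded_subst A _ _ hu
      have key : ∀ B : Ty C, ¬ Unguarded s 0 (shift s B) := by
        intro B hB
        obtain ⟨m, h3, -⟩ := unguarded_rename B _ _ hB
        simp at h3
      by_cases hst : s' = s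
      · subst hst
        cases n with
        | zero => exact h.1 h1
        | succ n => exact key _ (by simpa [up] using h2)
      · exact key _ (by simpa [up, hst] using h2)
    · by_cases hst : s' = s
      · cases n with
        | zero => simp [up, hst, Contractive]
        | succ n => simpa [up, hst, shift] using (hσ s n).rename _
      · simpa [up, hst, shift] using (hσ s' n).rename _

theorem HasSort.rename {s : Srt} {A : Ty C} (h : HasSort s A) :
    ∀ ρ, HasSort s (A.rename ρ) := by
  induction h with
  | var s n => intro ρ; exact .var _ _
  | const c => intro ρ; exact .const c
  | app _ _ ih1 ih2 => intro ρ; exact .app (ih1 ρ) (ih2 ρ)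
  | fn _ _ ih1 ih2 => intro ρ; exact .fn (ih1 ρ) (ih2 ρ)
  | union _ _ ih1 ih2 => intro ρ; exact .union (ih1 ρ) (ih2 ρ)
  | mu _ ih => intro ρ; exact .mu (ih _)
  | incl _ ih => intro ρ; exact .incl (ih ρ)

theorem HasSort.subst {s : Srt} {A : Ty C} (h : HasSort s A) : ∀ σ : Srt → ℕ → Ty C,
    (∀ s n, HasSort s (σ s n)) → HasSort s (A.subst σ) := by
  induction h with
  | var s n => intro σ hσ; exact hσ s n
  | const c => intro σ hσ; exact .const c
  | app _ _ ih1 ih2 => intro σ hσ; exact .app (ih1 σ hσ) (ih2 σ hσ)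
  | fn _ _ ih1 ih2 => intro σ hσ; exact .fn (ih1 σ hσ) (ih2 σ hσ)
  | union _ _ ih1 ih2 => intro σ hσ; exact .union (ih1 σ hσ) (ih2 σ hσ)
  | @mu s A _ ih =>
    refine fun σ hσ => .mu (ih _ fun s' n => ?_)
    by_cases hst : s' = s
    · subst hst
      cases n with
      | zero => simpa [up] using HasSort.var s' 0
      | succ n => simpa [up, shift] using (hσ s' n).rename _
    · simpa [up, hst, shift] using (hσ s' n).rename _
  | incl _ ih => intro σ hσ; exact .incl (ih σ hσ)

theorem WF.app_left {D A : Ty C} (h : WF (app D A)) : WF D := by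
  obtain ⟨h, hc, -⟩ := h
  cases h with | incl h => cases h with | app h1 _ => exact ⟨.incl h1, hc⟩

theorem WF.app_right {D A : Ty C} (h : WF (app D A)) : WF A := by
  obtain ⟨h, -, hc⟩ := h
  cases h with | incl h => cases h with | app _ h2 => exact ⟨h2, hc⟩

theorem WF.fn_left {A B : Ty C} (h : WF (fn A B)) : WF A := by
  obtain ⟨h, hc, -⟩ := h
  cases h with
  | fn h1 _ => exact ⟨h1, hc⟩
  | incl h => cases h

theorem WF.fn_right {A B : Ty C} (h : WF (fn A B)) : WF B := by
  obtain ⟨h, -, hc⟩ := h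
  cases h with
  | fn _ h2 => exact ⟨h2, hc⟩
  | incl h => cases h

theorem WF.union_left {A B : Ty C} (h : WF (union A B)) : WF A := by
  obtain ⟨h, hc, -⟩ := h
  cases h with
  | union h1 _ => exact ⟨h1, hc⟩
  | incl h => cases h with | union h1 _ => exact ⟨.incl h1, hc⟩

theorem WF.union_right {A B : Ty C} (h : WF (union A B)) : WF B := by
  obtain ⟨h, -, hc⟩ := h
  cases h with
  | union _ h2 => exact ⟨h2, hc⟩
  | incl h => cases h with | union _ h2 => exact ⟨.incl h2, hc⟩

theorem WF.unfold {s : Srt} {A : Ty C} (h : WF (mu s A)) : WF (inst s (mu s A) A) := by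
  obtain ⟨h, hc⟩ := h
  have hs : HasSort s A := by
    cases h with
    | mu h => exact h
    | incl h => cases h with | mu h => exact h
  refine ⟨?_, hc.2.subst _ fun s' n => ?_⟩
  · have : HasSort s (inst s (mu s A) A) := by
      refine hs.subst _ fun s' n => ?_
      by_cases hss : s' = s
      · subst hss
        cases n with
        | zero => simpa [single] using hs.mu
        | succ n => simpa [single] using HasSort.var s' n
      · simpa [single, hss] using HasSort.var s' n
    cases s with
    | data => exact .incl this
    | type => exact this
  · by_cases hss : s' = s
    · subst hss
      cases n with
      | zero => simpa [single] using hc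
      | succ n => simp [single, Contractive]
    · simp [single, hss, Contractive]

end Ty

/-- The set of contractive `μ`-types. -/
abbrev MuType (C : Type u) : Type u := {A : Ty C // A.WF}

/-! ## Type equivalence of `μ`-types -/

/-- Type equivalence of `μ`-types.  The premises `WF` and `HasSort` only say that the expressions in
a rule are contractive `μ`-types, formed in accordance with the sorts. -/
inductive EqMu {C : Type u} : Ty C → Ty C → Prop where
  | refl {A : Ty C} : A.WF → EqMu A A
  | trans {A B D : Ty C} : EqMu A B → EqMu B D → EqMu A D
  | symm {A B : Ty C} : EqMu A B → EqMu B A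
  | comp {D D' A A' : Ty C} : D.HasSort .data → D'.HasSort .data → EqMu D D' → EqMu A A' →
      EqMu (.app D A) (.app D' A')
  | func {A A' B B' : Ty C} : EqMu A A' → EqMu B B' → EqMu (.fn A B) (.fn A' B')
  | union_idem {A : Ty C} : A.WF → EqMu (.union A A) A
  | union_comm {A B : Ty C} : A.WF → B.WF → EqMu (.union A B) (.union B A)
  | union_assoc {A B D : Ty C} : A.WF → B.WF → D.WF →
      EqMu (.union A (.union B D)) (.union (.union A B) D)
  | union {A A' B B' : Ty C} : EqMu A A' → EqMu B B' → EqMu (.union A B) (.union A' B')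
  | mu {s : Srt} {A B : Ty C} : (Ty.mu s A).WF → (Ty.mu s B).WF → EqMu A B →
      EqMu (.mu s A) (.mu s B)
  | fold {s : Srt} {A : Ty C} : (Ty.mu s A).WF → EqMu (.mu s A) (Ty.inst s (.mu s A) A)
  | contr {s : Srt} {A B : Ty C} : A.HasSort s → (Ty.mu s B).WF → EqMu A (Ty.inst s A B) →
      EqMu A (.mu s B)

/-! ## Infinite trees with binary unions -/

/-- Nullary symbols: variables and type constants. -/
inductive Atom (C : Type u) : Type u where
  | var (s : Srt) (n : ℕ)
  | const (c : C)

/-- The ranked alphabet with a binary union symbol. -/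
inductive BSym (C : Type u) : Type u where
  | atom (a : Atom C)
  | app
  | fn
  | union

/-- The arity of a symbol. -/
abbrev BSym.arity {C : Type u} : BSym C → ℕ
  | .atom _ => 0
  | .app => 2
  | .fn => 2
  | .union => 2

/-- The signature with a binary union symbol. -/
abbrev BSig (C : Type u) : PFunctor.{u, 0} := ⟨BSym C, fun s => Fin s.arity⟩

/-- `Child t' t`: the tree `t'` is an immediate subtree of `t`. -/
def Child {C : Type u} (t' t : (BSig C).M) : Prop := ∃ i, t' = t.dest.2 i

/-- `UnionChild t' t`: the root of `t` is a union and `t'` is an immediate subtree of `t`. -/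
def UnionChild {C : Type u} (t' t : (BSig C).M) : Prop :=
  t.dest.1 = BSym.union ∧ Child t' t

/-- Possibly infinite trees without an infinite branch of unions, at the root or below. -/
abbrev BTree (C : Type u) : Type u :=
  {t : (BSig C).M // ∀ t', Relation.ReflTransGen Child t' t → Acc UnionChild t'}

namespace MuType

variable {C : Type u}

/-- The root symbol of the infinite unfolding of a `μ`-type, together with `μ`-types for the
immediate subtrees. -/
def step : MuType C → (BSig C).Obj (MuType C)
  | ⟨.var s n, _⟩ => ⟨BSym.atom (.var s n), Fin.elim0⟩
  | ⟨.const c, _⟩ => ⟨BSym.atom (.const c), Fin.elim0⟩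
  | ⟨.app D A, h⟩ => ⟨BSym.app, ![⟨D, h.app_left⟩, ⟨A, h.app_right⟩]⟩
  | ⟨.fn A B, h⟩ => ⟨BSym.fn, ![⟨A, h.fn_left⟩, ⟨B, h.fn_right⟩]⟩
  | ⟨.union A B, h⟩ => ⟨BSym.union, ![⟨A, h.union_left⟩, ⟨B, h.union_right⟩]⟩
  | ⟨.mu s A, h⟩ => step ⟨Ty.inst s (.mu s A) A, h.unfold⟩
  termination_by A => A.1.height
  decreasing_by
    simp only [Ty.height_inst h.2.1, Ty.height]
    omega

/-- The unfolding as a tree over the signature. -/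
def tree (A : MuType C) : (BSig C).M := PFunctor.M.corec step A

theorem step_height (A : MuType C) (h : (step A).1 = BSym.union) (i) :
    ((step A).2 i).1.height < A.1.height := by
  fun_induction step A with
  | case1 => cases h
  | case2 => cases h
  | case3 => cases h
  | case4 => cases h
  | case5 A B hAB =>
    change Fin 2 at i
    fin_cases i
    · exact Nat.lt_succ_of_le (le_max_left A.height B.height)
    · exact Nat.lt_succ_of_le (le_max_right A.height B.height)
  | case6 s A hA ih =>
    refine (ih h i).trans ?_
    simp only [Ty.height_inst hA.2.1, Ty.height]
    omega

theorem child_tree {A : MuType C} {t : (BSig C).M} (h : Child t A.tree) :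
    ∃ i, t = tree ((step A).2 i) := by
  obtain ⟨i, rfl⟩ := h
  exact ⟨i, rfl⟩

theorem acc_tree (A : MuType C) : Acc UnionChild A.tree := by
  induction hn : A.1.height using Nat.strong_induction_on generalizing A with
  | _ n ih =>
    refine ⟨_, fun t ht => ?_⟩
    obtain ⟨i, rfl⟩ := child_tree ht.2
    exact ih _ (hn ▸ step_height A ht.1 i) _ rfl

/-- The infinite unfolding of a `μ`-type. -/
def toBTree (A : MuType C) : BTree C :=
  ⟨A.tree, fun t h => by
    have key : ∃ B : MuType C, t = B.tree := by
      induction h using Relation.ReflTransGen.head_induction_on with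
      | refl => exact ⟨A, rfl⟩
      | head h _ ih =>
        obtain ⟨B, rfl⟩ := ih
        obtain ⟨i, hi⟩ := child_tree h
        exact ⟨_, hi⟩
    obtain ⟨B, rfl⟩ := key
    exact acc_tree B⟩

end MuType

/-! ## Infinite trees with unions of any finite arity -/

/-- The ranked alphabet with a union symbol of each arity `n > 1`. -/
inductive NSym (C : Type u) : Type u where
  | atom (a : Atom C)
  | app
  | fn
  | union (n : ℕ) (hn : 1 < n)

/-- The arity of a symbol. -/
abbrev NSym.arity {C : Type u} : NSym C → ℕ
  | .atom _ => 0
  | .app => 2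
  | .fn => 2
  | .union n _ => n

/-- The signature with `n`-ary union symbols. -/
abbrev NSig (C : Type u) : PFunctor.{u, 0} := ⟨NSym C, fun s => Fin s.arity⟩

/-- Possibly infinite trees over the alphabet with `n`-ary unions. -/
abbrev NTree (C : Type u) : Type u := (NSig C).M

namespace NTree

variable {C : Type u}

/-- The one-node tree. -/
def atom (a : Atom C) : NTree C := PFunctor.M.mk ⟨NSym.atom a, Fin.elim0⟩

/-- The tree with root `app`. -/
def app (D A : NTree C) : NTree C := PFunctor.M.mk ⟨NSym.app, ![D, A]⟩

/-- The tree with root `fn`. -/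
def fn (A B : NTree C) : NTree C := PFunctor.M.mk ⟨NSym.fn, ![A, B]⟩

/-- The tree with an `n`-ary union at the root. -/
def union {n : ℕ} (hn : 1 < n) (A : Fin n → NTree C) : NTree C :=
  PFunctor.M.mk ⟨NSym.union n hn, A⟩

/-- The root of the tree is a union. -/
def IsUnion (t : NTree C) : Prop := ∃ n hn, ∃ A : Fin n → NTree C, t = union hn A

end NTree

namespace BTree

variable {C : Type u}

/-- The root symbol and the immediate subtrees. -/
def dest (t : BTree C) : (BSig C).Obj (BTree C) :=
  ⟨t.1.dest.1, fun i => ⟨t.1.dest.2 i, fun t' h => t.2 t' (h.tail ⟨i, rfl⟩)⟩⟩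

/-- Trees are well-founded along branches of unions. -/
instance : WellFoundedRelation (BTree C) where
  rel t' t := UnionChild t'.1 t.1
  wf := ⟨fun t => InvImage.accessible Subtype.val (t.2 t.1 .refl)⟩

theorem rel_of_dest {t : BTree C} {f} (h : t.dest = ⟨BSym.union, f⟩) (i) :
    WellFoundedRelation.rel (f i) t := by
  have h1 : t.dest.1 = BSym.union := by rw [h]
  refine ⟨h1, ?_⟩
  have h2 : ∀ x : (BSig C).Obj (BTree C), t.dest = x → ∀ j, Child (x.2 j).1 t.1 := by
    rintro x rfl j
    exact ⟨j, rfl⟩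
  exact h2 _ h i

/-- The components `A₁, …, Aₙ` (none of them with a union at the root), from left to right, of a tree
written as a maximal union `A₁ ⊕ ⋯ ⊕ Aₙ`, irrespective of how the unions are associated. -/
def components (t : BTree C) : List (BTree C) :=
  match h : t.dest with
  | ⟨BSym.union, f⟩ => components (f (0 : Fin 2)) ++ components (f (1 : Fin 2))
  | ⟨BSym.atom _, _⟩ => [t]
  | ⟨BSym.app, _⟩ => [t]
  | ⟨BSym.fn, _⟩ => [t]
  termination_by t
  decreasing_by
    · exact rel_of_dest h _
    · exact rel_of_dest h _

theorem components_pos (t : BTree C) : 0 < t.components.length := by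
  fun_induction components t with
  | case1 t f h ih1 ih2 => rw [List.length_append]; omega
  | case2 => simp
  | case3 => simp
  | case4 => simp

theorem one_lt_components {t : BTree C} {f} (h : t.dest = ⟨BSym.union, f⟩) :
    1 < t.components.length := by
  have h0 := components_pos (f (0 : Fin 2))
  have h1 := components_pos (f (1 : Fin 2))
  rw [components]
  split
  · rename_i g hg
    rw [h] at hg
    cases hg
    rw [List.length_append]
    omega
  all_goals (rename_i hg; rw [h] at hg; cases hg)

/-- The root symbol of the translation to `n`-ary unions, together with the trees whose translations
are the immediate subtrees. -/
def nstep (t : BTree C) : (NSig C).Obj (BTree C) :=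
  match h : t.dest with
  | ⟨BSym.atom a, _⟩ => ⟨NSym.atom a, Fin.elim0⟩
  | ⟨BSym.app, f⟩ => ⟨NSym.app, f⟩
  | ⟨BSym.fn, f⟩ => ⟨NSym.fn, f⟩
  | ⟨BSym.union, _⟩ => ⟨NSym.union t.components.length (one_lt_components h), t.components.get⟩

/-- The translation that turns each maximal union into a single `n`-ary union. -/
def toNTree (t : BTree C) : NTree C := PFunctor.M.corec nstep t

end BTree

/-! ## Equivalence up to a set of hypotheses -/

variable {C : Type u}

/-- The generating function of the equivalence up to `R`: one application of a rule to premises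
in `X ∪ R`. -/
inductive EqUpStep (R X : NTree C → NTree C → Prop) : NTree C → NTree C → Prop where
  | refl (a : Atom C) : EqUpStep R X (.atom a) (.atom a)
  | comp {D D' A A' : NTree C} : (X ⊔ R) D D' → (X ⊔ R) A A' →
      EqUpStep R X (.app D A) (.app D' A')
  | func {A A' B B' : NTree C} : (X ⊔ R) A' A → (X ⊔ R) B B' →
      EqUpStep R X (.fn A B) (.fn A' B')
  | union {n m : ℕ} (hn : 1 < n) (hm : 1 < m) {A : Fin n → NTree C} {B : Fin m → NTree C}
      (f : Fin n → Fin m) (g : Fin m → Fin n) :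
      (∀ i, (X ⊔ R) (A i) (B (f i))) → (∀ j, (X ⊔ R) (A (g j)) (B j)) →
      (∀ i, ¬ (A i).IsUnion) → (∀ j, ¬ (B j).IsUnion) →
      EqUpStep R X (.union hn A) (.union hm B)
  | union_l {n : ℕ} (hn : 1 < n) {A : Fin n → NTree C} {B : NTree C} :
      (∀ i, (X ⊔ R) (A i) B) → (∀ i, ¬ (A i).IsUnion) → ¬ B.IsUnion →
      EqUpStep R X (.union hn A) B
  | union_r {m : ℕ} (hm : 1 < m) {A : NTree C} {B : Fin m → NTree C} :
      (∀ j, (X ⊔ R) A (B j)) → ¬ A.IsUnion → (∀ j, ¬ (B j).IsUnion) →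
      EqUpStep R X A (.union hm B)

theorem EqUpStep.mono {R X Y : NTree C → NTree C → Prop} (hXY : X ≤ Y) :
    EqUpStep R X ≤ EqUpStep R Y := by
  have k : ∀ {a b}, (X ⊔ R) a b → (Y ⊔ R) a b := fun {a b} h => h.imp (hXY a b) id
  intro a b h
  cases h with
  | refl a => exact .refl a
  | comp h1 h2 => exact .comp (k h1) (k h2)
  | func h1 h2 => exact .func (k h1) (k h2)
  | union hn hm f g h1 h2 h3 h4 =>
    exact .union hn hm f g (fun i => k (h1 i)) (fun j => k (h2 j)) h3 h4
  | union_l hn h1 h2 h3 => exact .union_l hn (fun i => k (h1 i)) h2 h3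
  | union_r hm h1 h2 h3 => exact .union_r hm (fun j => k (h1 j)) h2 h3

/-- The equivalence relation up to `R`: the rules are read coinductively. -/
def EqUp (R : NTree C → NTree C → Prop) : NTree C → NTree C → Prop :=
  OrderHom.gfp ⟨EqUpStep R, fun _ _ h => EqUpStep.mono h⟩

end CAP

universe u

/-! Both sides of the equivalence are compared with a third relation, `Bisim`. The heads of a
contractive type are the union components of its unfolding. Two types are bisimilar if, to every
finite depth of nested constructors, each head of one is matched by a head of the other with the
same root and matching arguments.

Soundness (`EqMu.bisim`) is an induction on the derivation. Only congruence of `mu` and the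
contraction rule need more than a direct check. There, contractivity gives a gain in depth
(`Approx.inst_of_guarded`): replacing a guarded variable by expressions that agree to depth `k`
gives results that agree to depth `k + 1`.

Completeness (`eqMu_of_bisim`) rests on regularity: only finitely many expressions are reachable
from a type by unfolding and taking arguments (`finite_closure`). Given bisimilar `A` and `B`, one
expression equivalent to both is built by following matching heads. Each visited pair gets a fresh
bound variable, and this variable is used when the pair recurs (`exists_common`); finiteness of the
set of pairs ends the process. The contraction rule identifies `A`, and likewise `B`, with the
resulting `mu`, because each solves its fixed-point equation. That equation is verified in the
semilattice of types modulo `EqMu`, where a type is the join of its heads.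

On the tree side, the components of the translated tree are exactly the trees of the heads
(`mem_components_ntree`), and the union rules match components in both directions. Hence bisimilar
pairs form a post-fixed point of the rules (`treeBisim_le`), and conversely equivalent trees agree
to every depth (`approx_of_eqUp`). -/

namespace CAP

variable {C : Type u}

namespace Ty

/-! ## Substitution -/

/-- The substitution that sends `var s 0` to `B`, and the remaining variables to their values
under `σ`. -/
def cons (s : Srt) (B : Ty C) (σ : Srt → ℕ → Ty C) (s' : Srt) (n : ℕ) : Ty C :=
  if s' = s then
    match n with
    | 0 => B
    | n + 1 => σ s' n
  else σ s' n

theorem rename_rename (A : Ty C) : ∀ ρ ρ' : Srt → ℕ → ℕ,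
    rename ρ' (rename ρ A) = rename (fun s n => ρ' s (ρ s n)) A := by
  induction A with
  | mu t A ih =>
    intro ρ ρ'
    simp only [rename, ih]
    congr 2
    funext s n
    by_cases h : s = t
    · cases n <;> simp [upRen, h]
    · simp [upRen, h]
  | _ => simp_all [rename]

theorem subst_rename (A : Ty C) : ∀ (ρ : Srt → ℕ → ℕ) (σ : Srt → ℕ → Ty C),
    subst σ (rename ρ A) = subst (fun s n => σ s (ρ s n)) A := by
  induction A with
  | mu t A ih =>
    intro ρ σ
    simp only [rename, subst, ih]
    congr 2
    funext s n
    by_cases h : s = t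
    · cases n <;> simp [upRen, up, h]
    · simp [upRen, up, h]
  | _ => simp_all [rename, subst]

theorem rename_upRen_shift (s : Srt) (ρ : Srt → ℕ → ℕ) (A : Ty C) :
    rename (upRen s ρ) (shift s A) = shift s (rename ρ A) := by
  simp only [shift, rename_rename]
  congr 1
  funext s' n
  by_cases h : s' = s <;> simp [upRen, h]

theorem rename_subst (A : Ty C) : ∀ (σ : Srt → ℕ → Ty C) (ρ : Srt → ℕ → ℕ),
    rename ρ (subst σ A) = subst (fun s n => rename ρ (σ s n)) A := by
  induction A with
  | mu t A ih =>
    intro σ ρ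
    simp only [rename, subst, ih]
    congr 2
    funext s n
    by_cases h : s = t
    · cases n <;> simp [upRen, up, h, rename, rename_upRen_shift]
    · simp [up, h, rename_upRen_shift]
  | _ => simp_all [rename, subst]

theorem subst_up_shift (s : Srt) (σ : Srt → ℕ → Ty C) (A : Ty C) :
    subst (up s σ) (shift s A) = shift s (subst σ A) := by
  simp only [shift, rename_subst, subst_rename]
  congr 1
  funext s' n
  by_cases h : s' = s <;> simp [up, shift, h]

theorem subst_subst (A : Ty C) : ∀ σ τ : Srt → ℕ → Ty C,
    subst τ (subst σ A) = subst (fun s n => subst τ (σ s n)) A := by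
  induction A with
  | mu t A ih =>
    intro σ τ
    simp only [subst, ih]
    congr 2
    funext s n
    by_cases h : s = t
    · cases n
      · simp [up, h, subst]
      · simp [up, h, subst_up_shift]
    · simp [up, h, subst_up_shift]
  | _ => simp_all [subst]

theorem subst_var (A : Ty C) : subst var A = A := by
  induction A with
  | mu t A ih =>
    have : up t (var : Srt → ℕ → Ty C) = var := by
      funext s n
      by_cases h : s = t
      · cases n <;> simp [up, h, shift, rename]
      · simp [up, h, shift, rename]
    simp [subst, this, ih]
  | _ => simp_all [subst]

theorem inst_shift (s : Srt) (B A : Ty C) : inst s B (shift s A) = A := by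
  rw [inst, shift, subst_rename]
  conv_rhs => rw [← subst_var A]
  congr 1
  funext s' n
  by_cases h : s' = s <;> simp [single, h]

/-- Turns the unfolding of a substituted binder into an extension of the environment by one entry,
the form in which `common_mu` meets the contraction rule. -/
theorem inst_subst_up (s : Srt) (B : Ty C) (σ : Srt → ℕ → Ty C) (A : Ty C) :
    inst s B (subst (up s σ) A) = subst (cons s B σ) A := by
  rw [inst, subst_subst]
  congr 1
  funext s' n
  by_cases h : s' = s
  · subst h
    cases n
    · simp [up, subst, cons, single]
    · simpa [up, cons, inst] using inst_shift s' B _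
  · simpa [up, cons, h, inst] using inst_shift s B _

theorem subst_inst (s : Srt) (B A : Ty C) (σ : Srt → ℕ → Ty C) :
    subst σ (inst s B A) = inst s (subst σ B) (subst (up s σ) A) := by
  rw [inst_subst_up, inst, subst_subst]
  congr 1
  funext s' n
  by_cases h : s' = s
  · subst h
    cases n <;> simp [single, cons, subst]
  · simp [single, cons, h, subst]

theorem HasSort.unfold {s t : Srt} {A : Ty C} (h : HasSort s (Ty.mu t A)) :
    HasSort s (inst t (.mu t A) A) := by
  have key : ∀ {t : Srt} {A : Ty C}, HasSort t A → HasSort t (inst t (.mu t A) A) := by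
    intro t A h
    refine h.subst _ fun s' n => ?_
    by_cases hs : s' = t
    · subst hs
      cases n with
      | zero => simpa [single] using h.mu
      | succ n => simpa [single] using HasSort.var s' n
    · simpa [single, hs] using HasSort.var s' n
  cases h with
  | mu h => exact key h
  | incl h => cases h with | mu h => exact .incl (key h)

theorem WF.subst {A : Ty C} (h : A.WF) {σ : Srt → ℕ → Ty C} (hs : ∀ s n, HasSort s (σ s n))
    (hc : ∀ s n, Contractive (σ s n)) : (A.subst σ).WF :=
  ⟨h.1.subst σ hs, h.2.subst σ hc⟩

/-! ## Heads -/

/-- `Head A h`: the expression `h`, whose root is neither a union nor a binder, is a component of the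
unfolding of `A` written as a maximal union. -/
inductive Head : Ty C → Ty C → Prop where
  | var (s : Srt) (n : ℕ) : Head (var s n) (var s n)
  | const (c : C) : Head (const c) (const c)
  | app (D A : Ty C) : Head (app D A) (app D A)
  | fn (A B : Ty C) : Head (fn A B) (fn A B)
  | union_left {A B h : Ty C} : Head A h → Head (union A B) h
  | union_right {A B h : Ty C} : Head B h → Head (union A B) h
  | mu {s : Srt} {A h : Ty C} : Head (inst s (mu s A) A) h → Head (mu s A) h

/-- Two expressions have the same root, which is neither a union nor a binder, and their immediate
subexpressions are related. -/
inductive HeadRel (X : Ty C → Ty C → Prop) : Ty C → Ty C → Prop where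
  | var (s : Srt) (n : ℕ) : HeadRel X (var s n) (var s n)
  | const (c : C) : HeadRel X (const c) (const c)
  | app {D D' A A' : Ty C} : X D D' → X A A' → HeadRel X (app D A) (app D' A')
  | fn {A A' B B' : Ty C} : X A A' → X B B' → HeadRel X (fn A B) (fn A' B')

theorem HeadRel.mono {X Y : Ty C → Ty C → Prop} (hXY : ∀ A B, X A B → Y A B) {A B : Ty C}
    (h : HeadRel X A B) : HeadRel Y A B := by
  cases h with
  | var s n => exact .var s n
  | const c => exact .const c
  | app h1 h2 => exact .app (hXY _ _ h1) (hXY _ _ h2)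
  | fn h1 h2 => exact .fn (hXY _ _ h1) (hXY _ _ h2)

theorem HeadRel.symm {X : Ty C → Ty C → Prop} (hX : ∀ A B, X A B → X B A) {A B : Ty C}
    (h : HeadRel X A B) : HeadRel X B A := by
  cases h with
  | var s n => exact .var s n
  | const c => exact .const c
  | app h1 h2 => exact .app (hX _ _ h1) (hX _ _ h2)
  | fn h1 h2 => exact .fn (hX _ _ h1) (hX _ _ h2)

theorem HeadRel.trans {X : Ty C → Ty C → Prop} (hX : ∀ A B D, X A B → X B D → X A D)
    {A B D : Ty C} (h : HeadRel X A B) (h' : HeadRel X B D) : HeadRel X A D := by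
  cases h with
  | var s n => exact h'
  | const c => exact h'
  | app h1 h2 => cases h' with | app h3 h4 => exact .app (hX _ _ _ h1 h3) (hX _ _ _ h2 h4)
  | fn h1 h2 => cases h' with | fn h3 h4 => exact .fn (hX _ _ _ h1 h3) (hX _ _ _ h2 h4)

/-- `HeadRel` excludes unions and binders at the root, and any other expression is its own only
head. -/
theorem HeadRel.head_iff_left {X : Ty C → Ty C → Prop} {A B : Ty C} (h : HeadRel X A B)
    (D : Ty C) : Head A D ↔ D = A := by
  cases h <;> exact ⟨fun h => by cases h; rfl, by rintro rfl; constructor⟩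

theorem HeadRel.head_iff_right {X : Ty C → Ty C → Prop} {A B : Ty C} (h : HeadRel X A B)
    (D : Ty C) : Head B D ↔ D = B := by
  cases h <;> exact ⟨fun h => by cases h; rfl, by rintro rfl; constructor⟩

theorem Head.headRel_self {X : Ty C → Ty C → Prop} (hX : ∀ A, X A A) {A h : Ty C}
    (hA : Head A h) : HeadRel X h h := by
  induction hA with
  | var s n => exact .var s n
  | const c => exact .const c
  | app D A => exact .app (hX D) (hX A)
  | fn A B => exact .fn (hX A) (hX B)
  | union_left _ ih => exact ih
  | union_right _ ih => exact ih
  | mu _ ih => exact ih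

theorem Head.wf {A h : Ty C} (hA : Head A h) (hw : A.WF) : h.WF := by
  induction hA with
  | union_left _ ih => exact ih hw.union_left
  | union_right _ ih => exact ih hw.union_right
  | mu _ ih => exact ih hw.unfold
  | _ => exact hw

theorem Head.hasSort_data {A h : Ty C} (hA : Head A h) (hs : HasSort .data A) :
    HasSort .data h := by
  induction hA with
  | union_left _ ih => cases hs with | union h1 h2 => exact ih h1
  | union_right _ ih => cases hs with | union h1 h2 => exact ih h2
  | mu _ ih => exact ih hs.unfold
  | _ => exact hs

theorem exists_head {A : Ty C} (hw : A.WF) : ∃ h, Head A h := by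
  induction hn : A.height using Nat.strong_induction_on generalizing A with
  | _ n ih =>
    cases A with
    | var s n => exact ⟨_, .var s n⟩
    | const c => exact ⟨_, .const c⟩
    | app D A => exact ⟨_, .app D A⟩
    | fn A B => exact ⟨_, .fn A B⟩
    | union A B =>
      simp only [height] at hn
      obtain ⟨h, hh⟩ := ih _ (by omega) hw.union_left rfl
      exact ⟨h, .union_left hh⟩
    | mu s A =>
      simp only [height] at hn
      obtain ⟨h, hh⟩ := ih _ (by rw [height_inst hw.2.1]; omega) hw.unfold rfl
      exact ⟨h, .mu hh⟩

/-- Heads are reached through unions and binders only, never through a type constructor. -/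
theorem Head.unguarded {A h : Ty C} (hA : Head A h) {s : Srt} {n : ℕ} (hh : h = Ty.var s n) :
    Unguarded s n A := by
  induction hA with
  | var s' n' => cases hh; exact ⟨rfl, rfl⟩
  | const c => cases hh
  | app D A => cases hh
  | fn A B => cases hh
  | union_left _ ih => exact .inl (ih hh)
  | union_right _ ih => exact .inr (ih hh)
  | @mu t A h _ ih =>
    obtain ⟨s', m, h1, h2⟩ := unguarded_subst A _ _ (ih hh)
    by_cases hst : s' = t
    · subst hst
      cases m with
      -- The occurrence lies in the inserted copy of the `mu` expression itself, which is the claim.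
      | zero => simpa [single] using h2
      | succ m =>
        obtain ⟨rfl, rfl⟩ : s' = s ∧ m = n := by simpa [single, Unguarded] using h2
        simpa [Unguarded] using h1
    · obtain ⟨rfl, rfl⟩ : s' = s ∧ m = n := by simpa [single, hst, Unguarded] using h2
      simpa [Unguarded, Ne.symm hst] using h1

/-- Induction on the derivation, not on `A`, since unfolding does not shrink `A`; the equation keeps
track of the original expression, and `subst_inst` carries it through a binder. The alternatives
overlap, as `h'` may be a variable. -/
theorem Head.of_subst {σ : Srt → ℕ → Ty C} {B h : Ty C} (hB : Head B h) :
    ∀ {A : Ty C}, B = subst σ A →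
      (∃ s n, Head A (Ty.var s n) ∧ Head (σ s n) h) ∨ ∃ h', Head A h' ∧ h = subst σ h' := by
  induction hB with
  | @union_left A₁ B₁ h h1 ih =>
    intro A hA
    cases A with
    | var s n => exact .inl ⟨s, n, .var s n, by rw [subst] at hA; exact hA ▸ .union_left h1⟩
    | union A B =>
      cases hA
      rcases ih rfl with ⟨s, n, h2, h3⟩ | ⟨h', h2, h3⟩
      · exact .inl ⟨s, n, .union_left h2, h3⟩
      · exact .inr ⟨h', .union_left h2, h3⟩
    | _ => cases hA
  | @union_right A₁ B₁ h h1 ih =>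
    intro A hA
    cases A with
    | var s n => exact .inl ⟨s, n, .var s n, by rw [subst] at hA; exact hA ▸ .union_right h1⟩
    | union A B =>
      cases hA
      rcases ih rfl with ⟨s, n, h2, h3⟩ | ⟨h', h2, h3⟩
      · exact .inl ⟨s, n, .union_right h2, h3⟩
      · exact .inr ⟨h', .union_right h2, h3⟩
    | _ => cases hA
  | @mu t A₁ h h1 ih =>
    intro A hA
    cases A with
    | var s n => exact .inl ⟨s, n, .var s n, by rw [subst] at hA; exact hA ▸ .mu h1⟩
    | mu s A =>
      cases hA
      rcases ih (subst_inst t (.mu t A) A σ).symm with ⟨s, n, h2, h3⟩ | ⟨h', h2, h3⟩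
      · exact .inl ⟨s, n, .mu h2, h3⟩
      · exact .inr ⟨h', .mu h2, h3⟩
    | _ => cases hA
  | var s n =>
    intro A hA
    cases A with
    | var s' n' => exact .inl ⟨s', n', .var _ _, by rw [subst] at hA; exact hA ▸ .var s n⟩
    | _ => cases hA
  | const c =>
    intro A hA
    cases A with
    | var s' n' => exact .inl ⟨s', n', .var _ _, by rw [subst] at hA; exact hA ▸ .const c⟩
    | const c' => exact .inr ⟨_, .const _, hA⟩
    | _ => cases hA
  | app D A =>
    intro A hA
    cases A with
    | var s' n' => exact .inl ⟨s', n', .var _ _, by rw [subst] at hA; exact hA ▸ .app _ _⟩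
    | app D' A' => exact .inr ⟨_, .app _ _, hA⟩
    | _ => cases hA
  | fn A B =>
    intro A hA
    cases A with
    | var s' n' => exact .inl ⟨s', n', .var _ _, by rw [subst] at hA; exact hA ▸ .fn _ _⟩
    | fn A' B' => exact .inr ⟨_, .fn _ _, hA⟩
    | _ => cases hA

theorem Head.subst {A h : Ty C} (hA : Head A h) (σ : Srt → ℕ → Ty C) {h' : Ty C}
    (hh : Head (subst σ h) h') : Head (subst σ A) h' := by
  induction hA with
  | union_left _ ih => exact .union_left (ih hh)
  | union_right _ ih => exact .union_right (ih hh)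
  | mu _ ih => exact .mu (by have := ih hh; rwa [subst_inst] at this)
  | _ => exact hh

/-! ## Bisimilarity up to a given depth -/

/-- Equivalence of the unfoldings up to the given number of nested type constructors. -/
def Approx : ℕ → Ty C → Ty C → Prop
  | 0, _, _ => True
  | k + 1, A, B => (∀ h, Head A h → ∃ h', Head B h' ∧ HeadRel (Approx k) h h') ∧
      ∀ h', Head B h' → ∃ h, Head A h ∧ HeadRel (Approx k) h h'

/-- Equivalence of the unfoldings up to any depth. -/
def Bisim (A B : Ty C) : Prop := ∀ k, Approx k A B

theorem Approx.refl : ∀ (k : ℕ) (A : Ty C), Approx k A A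
  | 0, _ => trivial
  | k + 1, _ => ⟨fun h hh => ⟨h, hh, hh.headRel_self (Approx.refl k)⟩,
      fun h hh => ⟨h, hh, hh.headRel_self (Approx.refl k)⟩⟩

theorem Approx.symm : ∀ {k : ℕ} {A B : Ty C}, Approx k A B → Approx k B A
  | 0, _, _, _ => trivial
  | k + 1, _, _, h => by
    refine ⟨fun x hx => ?_, fun x hx => ?_⟩
    · obtain ⟨y, hy, hxy⟩ := h.2 x hx
      exact ⟨y, hy, hxy.symm fun _ _ => Approx.symm⟩
    · obtain ⟨y, hy, hxy⟩ := h.1 x hx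
      exact ⟨y, hy, hxy.symm fun _ _ => Approx.symm⟩

theorem Approx.trans : ∀ {k : ℕ} {A B D : Ty C}, Approx k A B → Approx k B D → Approx k A D
  | 0, _, _, _, _, _ => trivial
  | k + 1, _, _, _, h, h' => by
    refine ⟨fun x hx => ?_, fun x hx => ?_⟩
    · obtain ⟨y, hy, hxy⟩ := h.1 x hx
      obtain ⟨z, hz, hyz⟩ := h'.1 y hy
      exact ⟨z, hz, hxy.trans (X := Approx k) (fun _ _ _ h h' => Approx.trans h h') hyz⟩
    · obtain ⟨y, hy, hxy⟩ := h'.2 x hx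
      obtain ⟨z, hz, hyz⟩ := h.2 y hy
      exact ⟨z, hz, hyz.trans (X := Approx k) (fun _ _ _ h h' => Approx.trans h h') hxy⟩

theorem Approx.of_succ : ∀ {k : ℕ} {A B : Ty C}, Approx (k + 1) A B → Approx k A B
  | 0, _, _, _ => trivial
  | k + 1, _, _, h => by
    refine ⟨fun x hx => ?_, fun x hx => ?_⟩
    · obtain ⟨y, hy, hxy⟩ := h.1 x hx
      exact ⟨y, hy, hxy.mono fun _ _ => Approx.of_succ⟩
    · obtain ⟨y, hy, hxy⟩ := h.2 x hx
      exact ⟨y, hy, hxy.mono fun _ _ => Approx.of_succ⟩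

theorem Approx.of_le {k l : ℕ} (hkl : k ≤ l) {A B : Ty C} (h : Approx l A B) : Approx k A B := by
  induction hkl with
  | refl => exact h
  | step _ ih => exact ih h.of_succ

theorem Approx.of_head_iff {A B : Ty C} (h : ∀ x, Head A x ↔ Head B x) (k : ℕ) :
    Approx k A B := by
  cases k with
  | zero => trivial
  | succ k =>
    exact ⟨fun x hx => ⟨x, (h x).1 hx, hx.headRel_self (Approx.refl k)⟩,
      fun x hx => ⟨x, (h x).2 hx, hx.headRel_self (Approx.refl k)⟩⟩

/-- The root constructor accounts for one level of depth. -/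
theorem HeadRel.approx {k : ℕ} {A B : Ty C} (h : HeadRel (Approx k) A B) :
    Approx (k + 1) A B :=
  ⟨fun x hx => ⟨B, (h.head_iff_right B).2 rfl, ((h.head_iff_left x).1 hx).symm ▸ h⟩,
    fun x hx => ⟨A, (h.head_iff_left A).2 rfl, ((h.head_iff_right x).1 hx).symm ▸ h⟩⟩

theorem Approx.union {k : ℕ} {A A' B B' : Ty C} (h : Approx k A A') (h' : Approx k B B') :
    Approx k (union A B) (union A' B') := by
  cases k with
  | zero => trivial
  | succ k =>
    refine ⟨fun x hx => ?_, fun x hx => ?_⟩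
    · cases hx with
      | union_left hx => obtain ⟨y, hy, hxy⟩ := h.1 x hx; exact ⟨y, .union_left hy, hxy⟩
      | union_right hx => obtain ⟨y, hy, hxy⟩ := h'.1 x hx; exact ⟨y, .union_right hy, hxy⟩
    · cases hx with
      | union_left hx => obtain ⟨y, hy, hxy⟩ := h.2 x hx; exact ⟨y, .union_left hy, hxy⟩
      | union_right hx => obtain ⟨y, hy, hxy⟩ := h'.2 x hx; exact ⟨y, .union_right hy, hxy⟩

theorem head_union_iff {A B h : Ty C} : Head (union A B) h ↔ Head A h ∨ Head B h :=
  ⟨fun h => by cases h with | union_left h => exact .inl h | union_right h => exact .inr h,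
    fun h => h.elim .union_left .union_right⟩

theorem head_mu_iff {s : Srt} {A h : Ty C} : Head (mu s A) h ↔ Head (inst s (mu s A) A) h :=
  ⟨fun h => by cases h with | mu h => exact h, .mu⟩

theorem HeadRel.subst_of_not_var {X Y : Ty C → Ty C → Prop} {σ τ : Srt → ℕ → Ty C} {A B : Ty C}
    (h : HeadRel X A B) (hv : ∀ s n, A ≠ Ty.var s n)
    (hXY : ∀ A B, X A B → Y (subst σ A) (subst τ B)) : HeadRel Y (subst σ A) (subst τ B) := by
  cases h with
  | var s n => exact absurd rfl (hv s n)
  | const c => exact .const c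
  | app h1 h2 => exact .app (hXY _ _ h1) (hXY _ _ h2)
  | fn h1 h2 => exact .fn (hXY _ _ h1) (hXY _ _ h2)

theorem HeadRel.head_left {X : Ty C → Ty C → Prop} {A B : Ty C} (h : HeadRel X A B) : Head A A :=
  (h.head_iff_left A).2 rfl

theorem HeadRel.head_right {X : Ty C → Ty C → Prop} {A B : Ty C} (h : HeadRel X A B) : Head B B :=
  (h.head_iff_right B).2 rfl

/-- One direction of a substitution lemma for `Approx`. -/
theorem exists_head_subst {k : ℕ} {A B : Ty C} {σ τ : Srt → ℕ → Ty C}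
    (hAB : ∀ h, Head A h → ∃ h', Head B h' ∧ HeadRel (Approx k) h h')
    (hvar : ∀ s n, Head A (var s n) → Approx (k + 1) (σ s n) (τ s n))
    (hsub : ∀ A B, Approx k A B → Approx k (subst σ A) (subst τ B))
    {h : Ty C} (hh : Head (subst σ A) h) :
    ∃ h', Head (subst τ B) h' ∧ HeadRel (Approx k) h h' := by
  -- A variable is matched only by itself, so it is also a head of `B`, and the values under `σ` and
  -- `τ` can be compared. Depth `k + 1` is needed only for variables that are heads; all others sit
  -- below a constructor.
  have var_case : ∀ s n, Head A (var s n) → Head (σ s n) h →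
      ∃ h', Head (subst τ B) h' ∧ HeadRel (Approx k) h h' := by
    intro s n h1 h2
    obtain ⟨y, hy, hxy⟩ := hAB _ h1
    cases hxy
    obtain ⟨z, hz, hyz⟩ := (hvar s n h1).1 h h2
    exact ⟨z, hy.subst τ hz, hyz⟩
  rcases hh.of_subst rfl with ⟨s, n, h1, h2⟩ | ⟨x, hx, rfl⟩
  · exact var_case s n h1 h2
  -- If the head `x` of `A` is itself a variable, its image is already known to be a head, hence a
  -- head of itself, and the first case applies.
  · by_cases hv : ∃ s n, x = var s n
    · obtain ⟨s, n, rfl⟩ := hv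
      refine var_case s n hx ?_
      obtain ⟨y, hy, hxy⟩ := hAB _ hx
      exact (hh.headRel_self (X := fun _ _ => True) fun _ => trivial).head_left
    · push Not at hv
      obtain ⟨y, hy, hxy⟩ := hAB _ hx
      have := hxy.subst_of_not_var hv hsub
      exact ⟨_, hy.subst τ this.head_right, this⟩

theorem Approx.subst : ∀ {k : ℕ} {A B : Ty C} {σ τ : Srt → ℕ → Ty C}, Approx k A B →
    (∀ s n, Approx k (σ s n) (τ s n)) → Approx k (subst σ A) (subst τ B)
  | 0, _, _, _, _, _, _ => trivial
  | k + 1, A, B, σ, τ, h, hστ => by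
    refine ⟨fun x hx => exists_head_subst h.1 (fun s n _ => hστ s n)
      (fun A B hAB => hAB.subst fun s n => (hστ s n).of_succ) hx, fun x hx => ?_⟩
    obtain ⟨y, hy, hxy⟩ := exists_head_subst h.symm.1 (fun s n _ => (hστ s n).symm)
      (fun A B hAB => hAB.subst fun s n => (hστ s n).symm.of_succ) hx
    exact ⟨y, hy, hxy.symm fun _ _ => Approx.symm⟩

/-- The replaced variable is not a head of `A`, so `B` and `B'` enter only below a constructor,
where agreement to depth `k` suffices. This makes the inductions on depth for `mu` and for
contraction work. -/
theorem Approx.inst_of_guarded {k : ℕ} {s : Srt} {A B B' : Ty C} (hA : ¬ Unguarded s 0 A)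
    (h : Approx k B B') : Approx (k + 1) (inst s B A) (inst s B' A) := by
  have key : ∀ {B B' : Ty C}, Approx k B B' → ∀ x, Head (inst s B A) x →
      ∃ y, Head (inst s B' A) y ∧ HeadRel (Approx k) x y := by
    intro B B' h x hx
    refine exists_head_subst (Approx.refl (k + 1) A).1 (fun s' n hv => ?_)
      (fun A B hAB => hAB.subst fun s' n => ?_) hx
    · by_cases hs : s' = s
      · subst hs
        cases n with
        | zero => exact absurd (hv.unguarded rfl) hA
        | succ n => simpa [single] using Approx.refl (k + 1) _
      · simpa [single, hs] using Approx.refl (k + 1) _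
    · by_cases hs : s' = s
      · subst hs
        cases n with
        | zero => simpa [single] using h
        | succ n => simpa [single] using Approx.refl k _
      · simpa [single, hs] using Approx.refl k _
  refine ⟨key h, fun x hx => ?_⟩
  obtain ⟨y, hy, hxy⟩ := key h.symm x hx
  exact ⟨y, hy, hxy.symm fun _ _ => Approx.symm⟩

end Ty

/-! ### Soundness of the equational rules. -/

open Ty

/-- Soundness: equivalent types are bisimilar. -/
theorem EqMu.bisim {A B : Ty C} (h : EqMu A B) : Bisim A B := by
  induction h with
  | refl _ => exact fun k => .refl k _
  | trans _ _ ih1 ih2 => exact fun k => (ih1 k).trans (ih2 k)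
  | symm _ ih => exact fun k => (ih k).symm
  | comp _ _ _ _ ih1 ih2 => exact fun k => (HeadRel.app (ih1 k) (ih2 k)).approx.of_succ
  | func _ _ ih1 ih2 => exact fun k => (HeadRel.fn (ih1 k) (ih2 k)).approx.of_succ
  | union_idem _ => exact .of_head_iff fun x => by simp only [head_union_iff, or_self]
  | union_comm _ _ => exact .of_head_iff fun x => by simp only [head_union_iff, or_comm]
  | union_assoc _ _ _ => exact .of_head_iff fun x => by simp only [head_union_iff, or_assoc]
  | union _ _ ih1 ih2 => exact fun k => (ih1 k).union (ih2 k)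
  -- Unfold, exchange the body `A` for `B` by the premise, then exchange the inserted `mu s A` for
  -- `mu s B`, which agree to one level less by the induction on `k`; `B` is guarded.
  | @mu s A B _ hB _ ih =>
    intro k
    induction k with
    | zero => trivial
    | succ k ihk =>
      exact ((Approx.of_head_iff (fun x => head_mu_iff) _).trans
        ((ih (k + 1)).subst fun _ _ => .refl _ _)).trans
        ((Approx.inst_of_guarded hB.2.1 ihk).trans
        (Approx.of_head_iff (fun x => head_mu_iff.symm) _))
  | fold _ => exact .of_head_iff fun x => head_mu_iff
  -- The solution `A` agrees with its own instance of `B`, and guardedness raises its agreement with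
  -- `mu s B` from depth `k` to `k + 1`: uniqueness of guarded fixed points.
  | @contr s A B _ hB _ ih =>
    intro k
    induction k with
    | zero => trivial
    | succ k ihk =>
      exact (ih (k + 1)).trans ((Approx.inst_of_guarded hB.2.1 ihk).trans
        (Approx.of_head_iff (fun x => head_mu_iff.symm) _))

namespace Ty

/-! ## The finite set of expressions reachable by unfolding -/

/-- A finite set of expressions which contains the given one and is closed under taking immediate
subexpressions and under unfolding at the root. -/
def closure : Ty C → Set (Ty C)
  | var s n => {var s n}
  | const c => {const c}
  | app D A => insert (app D A) (closure D ∪ closure A)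
  | fn A B => insert (fn A B) (closure A ∪ closure B)
  | union A B => insert (union A B) (closure A ∪ closure B)
  | mu s A => insert (mu s A) (inst s (mu s A) '' closure A)

/-- `SubStep A B`: the expression `B` is an immediate subexpression of `A` or the unfolding of `A`
at the root. -/
inductive SubStep : Ty C → Ty C → Prop where
  | app_left (D A : Ty C) : SubStep (app D A) D
  | app_right (D A : Ty C) : SubStep (app D A) A
  | fn_left (A B : Ty C) : SubStep (fn A B) A
  | fn_right (A B : Ty C) : SubStep (fn A B) B
  | union_left (A B : Ty C) : SubStep (union A B) A
  | union_right (A B : Ty C) : SubStep (union A B) B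
  | mu (s : Srt) (A : Ty C) : SubStep (mu s A) (inst s (mu s A) A)

theorem self_mem_closure (A : Ty C) : A ∈ closure A := by
  cases A <;> simp [closure]

theorem finite_closure (A : Ty C) : (closure A).Finite := by
  induction A with
  | var s n => exact Set.finite_singleton _
  | const c => exact Set.finite_singleton _
  | app D A ihD ihA => exact (ihD.union ihA).insert _
  | fn A B ihA ihB => exact (ihA.union ihB).insert _
  | union A B ihA ihB => exact (ihA.union ihB).insert _
  | mu s A ih => exact (ih.image _).insert _

theorem SubStep.of_subst {σ : Srt → ℕ → Ty C} {A B : Ty C} (h : SubStep (subst σ A) B) :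
    (∃ s n, A = Ty.var s n) ∨ ∃ A', SubStep A A' ∧ B = subst σ A' := by
  cases A with
  | var s n => exact .inl ⟨s, n, rfl⟩
  | const c => cases h
  | app D A =>
    cases h with
    | app_left => exact .inr ⟨_, .app_left _ _, rfl⟩
    | app_right => exact .inr ⟨_, .app_right _ _, rfl⟩
  | fn D A =>
    cases h with
    | fn_left => exact .inr ⟨_, .fn_left _ _, rfl⟩
    | fn_right => exact .inr ⟨_, .fn_right _ _, rfl⟩
  | union D A =>
    cases h with
    | union_left => exact .inr ⟨_, .union_left _ _, rfl⟩
    | union_right => exact .inr ⟨_, .union_right _ _, rfl⟩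
  | mu s A =>
    cases h with
    | mu => exact .inr ⟨_, .mu _ _, (subst_inst s (.mu s A) A σ).symm⟩

/-- In the binder case a step from an instance of `Z` is the instance of a step from `Z`, unless `Z`
is a variable; this is why the closure of the body may be taken before substituting. -/
theorem SubStep.mem_closure {A X Y : Ty C} (hX : X ∈ closure A) (h : SubStep X Y) :
    Y ∈ closure A := by
  induction A generalizing X Y with
  | var s n => cases hX; cases h
  | const c => cases hX; cases h
  | app D A ihD ihA =>
    rcases hX with rfl | hX | hX
    · cases h with
      | app_left => exact .inr (.inl (self_mem_closure _))
      | app_right => exact .inr (.inr (self_mem_closure _))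
    · exact .inr (.inl (ihD hX h))
    · exact .inr (.inr (ihA hX h))
  | fn D A ihD ihA =>
    rcases hX with rfl | hX | hX
    · cases h with
      | fn_left => exact .inr (.inl (self_mem_closure _))
      | fn_right => exact .inr (.inr (self_mem_closure _))
    · exact .inr (.inl (ihD hX h))
    · exact .inr (.inr (ihA hX h))
  | union D A ihD ihA =>
    rcases hX with rfl | hX | hX
    · cases h with
      | union_left => exact .inr (.inl (self_mem_closure _))
      | union_right => exact .inr (.inr (self_mem_closure _))
    · exact .inr (.inl (ihD hX h))
    · exact .inr (.inr (ihA hX h))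
  | mu s A ih =>
    have root : ∀ {Y}, SubStep (.mu s A) Y → Y ∈ closure (.mu s A) := by
      intro Y h
      cases h
      exact .inr ⟨A, self_mem_closure A, rfl⟩
    rcases hX with rfl | ⟨Z, hZ, rfl⟩
    · exact root h
    · rcases h.of_subst with ⟨s', n, rfl⟩ | ⟨Z', hZ', rfl⟩
      · by_cases hs : s' = s
        · subst hs
          cases n with
          -- The instance of the bound variable is the `mu` expression itself, so its step is the
          -- step from the root.
          | zero => exact root (by simpa [inst, subst, single] using h)
          | succ n => simp only [inst, subst, single, if_true] at h; cases h
        · simp only [inst, subst, single, if_neg hs] at h; cases h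
      · exact .inr ⟨Z', ih hZ hZ', rfl⟩

theorem Head.mem_closure {A X h : Ty C} (hX : X ∈ closure A) (hh : Head X h) : h ∈ closure A := by
  induction hh with
  | union_left _ ih => exact ih (SubStep.mem_closure hX (.union_left _ _))
  | union_right _ ih => exact ih (SubStep.mem_closure hX (.union_right _ _))
  | mu _ ih => exact ih (SubStep.mem_closure hX (.mu _ _))
  | _ => exact hX

theorem finite_head (A : Ty C) : {h | Head A h}.Finite :=
  (finite_closure A).subset fun _ hh => hh.mem_closure (self_mem_closure A)

/-! ## Bisimilarity is a bisimulation -/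

theorem HeadRel.of_forall_approx {A B : Ty C} (h : ∀ k, HeadRel (Approx k) A B) :
    HeadRel Bisim A B := by
  cases h 0 with
  | var s n => exact .var s n
  | const c => exact .const c
  | app => exact .app (fun k => by cases h k; assumption) (fun k => by cases h k; assumption)
  | fn => exact .fn (fun k => by cases h k; assumption) (fun k => by cases h k; assumption)

theorem Bisim.symm {A B : Ty C} (h : Bisim A B) : Bisim B A := fun k => (h k).symm

/-- A compactness argument: the matching head of `B` may depend on the depth, but `B` has finitely
many heads, so one of them works at every depth. -/
theorem Bisim.exists_head {A B h : Ty C} (hAB : Bisim A B) (hh : Head A h) :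
    ∃ h', Head B h' ∧ HeadRel Bisim h h' := by
  by_contra! hcon
  have key : ∀ h', ∃ k, Head B h' → ¬ HeadRel (Approx k) h h' := by
    intro h'
    by_contra! hk
    exact hcon h' (hk 0).1 (.of_forall_approx fun k => (hk k).2)
  choose k hk using key
  -- `N` bounds the depths at which the heads of `B` fail; a match at depth `N` contradicts the
  -- failure of that head.
  obtain ⟨N, hN⟩ := ((finite_head B).image k).bddAbove
  obtain ⟨h', h1, h2⟩ := (hAB (N + 1)).1 h hh
  exact hk h' h1 (h2.mono fun _ _ => Approx.of_le (hN ⟨h', h1, rfl⟩))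

theorem Bisim.exists_head_right {A B h : Ty C} (hAB : Bisim A B) (hh : Head B h) :
    ∃ h', Head A h' ∧ HeadRel Bisim h' h := by
  obtain ⟨h', h1, h2⟩ := hAB.symm.exists_head hh
  exact ⟨h', h1, h2.symm fun _ _ => Bisim.symm⟩

theorem HeadRel.bisim {A B : Ty C} (h : HeadRel Bisim A B) : Bisim A B :=
  fun k => (h.mono fun _ _ hb => hb k).approx.of_succ

/-! ### Sorts and contractivity of compound expressions. -/

theorem HasSort.to_type {s : Srt} {A : Ty C} (h : HasSort s A) : HasSort .type A := by
  cases s with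
  | data => exact .incl h
  | type => exact h

theorem WF.union {A B : Ty C} (hA : A.WF) (hB : B.WF) : (union A B).WF :=
  ⟨.union hA.1 hB.1, hA.2, hB.2⟩

theorem WF.fn {A B : Ty C} (hA : A.WF) (hB : B.WF) : (fn A B).WF :=
  ⟨.fn hA.1 hB.1, hA.2, hB.2⟩

theorem WF.app {D A : Ty C} (hs : HasSort .data D) (hD : D.WF) (hA : A.WF) : (app D A).WF :=
  ⟨.incl (.app hs hA.1), hD.2, hA.2⟩

theorem WF.app_hasSort {D A : Ty C} (h : (Ty.app D A).WF) : HasSort .data D := by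
  cases h.1 with | incl h => cases h with | app h1 _ => exact h1

theorem hasSort_type_var (s : Srt) (n : ℕ) : HasSort .type (var s n : Ty C) :=
  (HasSort.var s n).to_type

end Ty

theorem EqMu.wf {A B : Ty C} (h : EqMu A B) : A.WF ∧ B.WF := by
  induction h with
  | refl h => exact ⟨h, h⟩
  | trans _ _ ih1 ih2 => exact ⟨ih1.1, ih2.2⟩
  | symm _ ih => exact ih.symm
  | comp h1 h2 _ _ ih1 ih2 => exact ⟨.app h1 ih1.1 ih2.1, .app h2 ih1.2 ih2.2⟩
  | func _ _ ih1 ih2 => exact ⟨.fn ih1.1 ih2.1, .fn ih1.2 ih2.2⟩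
  | union_idem h => exact ⟨h.union h, h⟩
  | union_comm h1 h2 => exact ⟨h1.union h2, h2.union h1⟩
  | union_assoc h1 h2 h3 => exact ⟨h1.union (h2.union h3), (h1.union h2).union h3⟩
  | union _ _ ih1 ih2 => exact ⟨ih1.1.union ih2.1, ih1.2.union ih2.2⟩
  | mu h1 h2 _ _ => exact ⟨h1, h2⟩
  | fold h => exact ⟨h, h.unfold⟩
  | contr _ h _ ih => exact ⟨ih.1, h⟩

/-! ## The semilattice of types -/

/-- The order for which the union is the join. -/
def LeMu (A B : Ty C) : Prop := EqMu (.union A B) B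

namespace LeMu

theorem wf_left {A B : Ty C} (h : LeMu A B) : A.WF := (EqMu.wf h).1.union_left

theorem wf_right {A B : Ty C} (h : LeMu A B) : B.WF := (EqMu.wf h).2

theorem of_eq {A B : Ty C} (h : EqMu A B) : LeMu A B :=
  (EqMu.union h (.refl h.wf.2)).trans (.union_idem h.wf.2)

theorem trans {A B D : Ty C} (h : LeMu A B) (h' : LeMu B D) : LeMu A D :=
  ((EqMu.union (.refl h.wf_left) h'.symm).trans
    (.union_assoc h.wf_left h'.wf_left h'.wf_right)).trans
    ((EqMu.union h (.refl h'.wf_right)).trans h')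

theorem antisymm {A B : Ty C} (h : LeMu A B) (h' : LeMu B A) : EqMu A B :=
  (h'.symm.trans (.union_comm h.wf_right h.wf_left)).trans h

theorem left {A B : Ty C} (hA : A.WF) (hB : B.WF) : LeMu A (.union A B) :=
  (EqMu.union_assoc hA hA hB).trans (.union (.union_idem hA) (.refl hB))

theorem right {A B : Ty C} (hA : A.WF) (hB : B.WF) : LeMu B (.union A B) :=
  (left hB hA).trans (of_eq (.union_comm hB hA))

theorem union {A B D : Ty C} (h : LeMu A D) (h' : LeMu B D) : LeMu (.union A B) D :=
  (EqMu.union_assoc h.wf_left h'.wf_left h.wf_right).symm.trans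
    ((EqMu.union (.refl h.wf_left) h').trans h)

theorem of_head {A h : Ty C} (hA : A.WF) (hh : Head A h) : LeMu h A := by
  induction hh with
  | union_left _ ih => exact (ih hA.union_left).trans (left hA.union_left hA.union_right)
  | union_right _ ih => exact (ih hA.union_right).trans (right hA.union_left hA.union_right)
  | mu _ ih => exact (ih hA.unfold).trans (of_eq (EqMu.fold hA).symm)
  | _ => exact of_eq (.refl hA)

/-- Together with `of_head`, this says that a type is the join of its heads. The height decreases
because unfolding a contractive binder keeps the height of its body. -/
theorem of_forall_head {A B : Ty C} (hA : A.WF) (h : ∀ x, Head A x → LeMu x B) : LeMu A B := by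
  induction hn : A.height using Nat.strong_induction_on generalizing A with
  | _ n ih =>
    cases A with
    | var s n => exact h _ (.var s n)
    | const c => exact h _ (.const c)
    | app D A => exact h _ (.app D A)
    | fn A B => exact h _ (.fn A B)
    | union A B =>
      simp only [height] at hn
      exact union (ih _ (by omega) hA.union_left (fun x hx => h x (.union_left hx)) rfl)
        (ih _ (by omega) hA.union_right (fun x hx => h x (.union_right hx)) rfl)
    | mu s A =>
      simp only [height] at hn
      exact (of_eq (.fold hA)).trans
        (ih _ (by rw [height_inst hA.2.1]; omega) hA.unfold (fun x hx => h x (.mu hx)) rfl)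

end LeMu

/-! ## Completeness -/

/-- All values of the substitution are contractive and respect the sorts. -/
def Env (σ : Srt → ℕ → Ty C) : Prop := ∀ s n, HasSort s (σ s n) ∧ Contractive (σ s n)

theorem Env.wf_subst {σ : Srt → ℕ → Ty C} (h : Env σ) {A : Ty C} (hA : A.WF) : (subst σ A).WF :=
  hA.subst (fun s n => (h s n).1) (fun s n => (h s n).2)

theorem Env.cons {σ : Srt → ℕ → Ty C} (h : Env σ) {s : Srt} {A : Ty C} (hs : HasSort s A)
    (hA : Contractive A) : Env (Ty.cons s A σ) := by
  intro s' n
  by_cases hss : s' = s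
  · subst hss
    cases n with
    | zero => simpa [Ty.cons] using ⟨hs, hA⟩
    | succ n => simpa [Ty.cons] using h s' n
  · simpa [Ty.cons, hss] using h s' n

/-- The expression `E` is a common generalization of `A` and `B`, which become equivalent to the
instances of `E` under the two substitutions. -/
structure Common (σ τ : Srt → ℕ → Ty C) (A B E : Ty C) : Prop where
  wf : E.WF
  sort : HasSort .data A → HasSort .data B → HasSort .data E
  left : EqMu (subst σ E) A
  right : EqMu (subst τ E) B

/-- The index that `cons s` gives to the variable `var t m`. -/
def bump (s t : Srt) (m : ℕ) : ℕ := if t = s then m + 1 else m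

theorem cons_bump (s t : Srt) (m : ℕ) (A : Ty C) (σ : Srt → ℕ → Ty C) :
    Ty.cons s A σ t (bump s t m) = σ t m := by
  by_cases h : t = s <;> simp [Ty.cons, bump, h]

theorem cons_zero (s : Srt) (A : Ty C) (σ : Srt → ℕ → Ty C) : Ty.cons s A σ s 0 = A := by
  simp [Ty.cons]

/-- The pair `A`, `B` is assigned to a variable. -/
def Assigned (σ τ : Srt → ℕ → Ty C) (A B : Ty C) : Prop :=
  ∃ s m, σ s m = A ∧ τ s m = B ∧ (HasSort .data A → HasSort .data B → s = .data)

/-- The generalizations of the arguments are used below the common constructor, so the new variable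
for the pair `A`, `B` stays guarded. By `hvar`, each free variable has a preimage common to both
environments, which generalizes a variable head. -/
theorem common_of_headRel {σ τ : Srt → ℕ → Ty C} {s : Srt} {A B h h' : Ty C}
    (hσ : Env (Ty.cons s A σ)) (hτ : Env (Ty.cons s B τ))
    (hvar : ∀ t n, ∃ m, σ t m = .var t n ∧ τ t m = .var t n)
    {X : Ty C → Ty C → Prop} (hh : HeadRel X h h') (hw : h.WF) (hw' : h'.WF)
    (ih : ∀ {D D' : Ty C}, SubStep h D → SubStep h' D' → D.WF → D'.WF → X D D' →
      ∃ E, Common (Ty.cons s A σ) (Ty.cons s B τ) D D' E) :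
    ∃ E, ¬ Unguarded s 0 E ∧ Common (Ty.cons s A σ) (Ty.cons s B τ) h h' E := by
  cases hh with
  | var t n =>
    obtain ⟨m, h1, h2⟩ := hvar t n
    refine ⟨.var t (bump s t m), ?_, ⟨hasSort_type_var _ _, trivial⟩, fun h _ => ?_, ?_, ?_⟩
    · rintro ⟨rfl, h3⟩
      simp [bump] at h3
    · cases h; exact .var _ _
    · rw [subst, cons_bump, h1]; exact .refl hw
    · rw [subst, cons_bump, h2]; exact .refl hw
  | const c =>
    exact ⟨.const c, id, hw, fun h _ => h, .refl hw, .refl hw⟩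
  | @app D D' G G' h1 h2 =>
    obtain ⟨E, hE⟩ := ih (.app_left _ _) (.app_left _ _) hw.app_left hw'.app_left h1
    obtain ⟨F, hF⟩ := ih (.app_right _ _) (.app_right _ _) hw.app_right hw'.app_right h2
    have hs := hE.sort hw.app_hasSort hw'.app_hasSort
    exact ⟨.app E F, id, .app hs hE.wf hF.wf, fun _ _ => .app hs hF.wf.1,
      .comp (hs.subst _ fun s n => (hσ s n).1) hw.app_hasSort hE.left hF.left,
      .comp (hs.subst _ fun s n => (hτ s n).1) hw'.app_hasSort hE.right hF.right⟩
  | @fn D D' G G' h1 h2 =>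
    obtain ⟨E, hE⟩ := ih (.fn_left _ _) (.fn_left _ _) hw.fn_left hw'.fn_left h1
    obtain ⟨F, hF⟩ := ih (.fn_right _ _) (.fn_right _ _) hw.fn_right hw'.fn_right h2
    exact ⟨.fn E F, id, .fn hE.wf hF.wf, (fun h => by cases h),
      .func hE.left hF.left, .func hE.right hF.right⟩

/-- `F` is the union of the generalizations of all pairs. Its two instances are characterized as
least upper bounds, which avoids any bookkeeping of order and repetitions. The list is nonempty
because there is no empty union. -/
theorem exists_join {σ τ : Srt → ℕ → Ty C} (hσ : Env σ) (hτ : Env τ) {s : Srt}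
    (l : List (Ty C × Ty C)) (hl : l ≠ [])
    (hcom : ∀ p ∈ l, ∃ E, ¬ Unguarded s 0 E ∧ Common σ τ p.1 p.2 E) :
    ∃ F : Ty C, ¬ Unguarded s 0 F ∧ F.WF ∧
      ((∀ p ∈ l, HasSort .data p.1 ∧ HasSort .data p.2) → HasSort .data F) ∧
      ((∀ p ∈ l, LeMu p.1 (subst σ F)) ∧
        ∀ T, (∀ p ∈ l, LeMu p.1 T) → LeMu (subst σ F) T) ∧
      ((∀ p ∈ l, LeMu p.2 (subst τ F)) ∧
        ∀ T, (∀ p ∈ l, LeMu p.2 T) → LeMu (subst τ F) T) := by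
  induction l with
  | nil => exact absurd rfl hl
  | cons p l ih =>
    obtain ⟨E, hu, hE⟩ := hcom p List.mem_cons_self
    cases l with
    | nil =>
      simp only [List.mem_singleton, forall_eq]
      exact ⟨E, hu, hE.wf, fun h => hE.sort h.1 h.2,
        ⟨.of_eq hE.left.symm, fun T hT => (LeMu.of_eq hE.left).trans hT⟩,
        ⟨.of_eq hE.right.symm, fun T hT => (LeMu.of_eq hE.right).trans hT⟩⟩
    | cons q l =>
      obtain ⟨F, hu', hF, hs, ⟨h1, h2⟩, ⟨h3, h4⟩⟩ :=
        ih (List.cons_ne_nil _ _) fun p hp => hcom p (List.mem_cons_of_mem _ hp)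
      refine ⟨.union E F, not_or.2 ⟨hu, hu'⟩, hE.wf.union hF, fun h => ?_,
        ⟨fun p hp => ?_, fun T hT => ?_⟩, ⟨fun p hp => ?_, fun T hT => ?_⟩⟩
      · obtain ⟨h5, h6⟩ := h p List.mem_cons_self
        exact .union (hE.sort h5 h6) (hs fun p hp => h p (List.mem_cons_of_mem _ hp))
      · rcases List.mem_cons.1 hp with rfl | hp
        · exact (LeMu.of_eq hE.left.symm).trans (.left (hσ.wf_subst hE.wf) (hσ.wf_subst hF))
        · exact (h1 p hp).trans (.right (hσ.wf_subst hE.wf) (hσ.wf_subst hF))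
      · exact .union ((LeMu.of_eq hE.left).trans (hT p List.mem_cons_self))
          (h2 T fun p hp => hT p (List.mem_cons_of_mem _ hp))
      · rcases List.mem_cons.1 hp with rfl | hp
        · exact (LeMu.of_eq hE.right.symm).trans (.left (hτ.wf_subst hE.wf) (hτ.wf_subst hF))
        · exact (h3 p hp).trans (.right (hτ.wf_subst hE.wf) (hτ.wf_subst hF))
      · exact .union ((LeMu.of_eq hE.right).trans (hT p List.mem_cons_self))
          (h4 T fun p hp => hT p (List.mem_cons_of_mem _ hp))

/-- By `inst_subst_up`, the hypotheses say that `A` and `B` solve the fixed-point equations of the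
two instances of `mu s F`; the contraction rule concludes. -/
theorem common_mu {σ τ : Srt → ℕ → Ty C} (hσ : Env σ) (hτ : Env τ) {s : Srt} {A B F : Ty C}
    (hA : HasSort s A) (hB : HasSort s B) (hs : HasSort .data A → HasSort .data B → s = .data)
    (hF : HasSort s F) (hc : Contractive F) (hu : ¬ Unguarded s 0 F)
    (h1 : EqMu A (subst (Ty.cons s A σ) F)) (h2 : EqMu B (subst (Ty.cons s B τ) F)) :
    Common σ τ A B (.mu s F) := by
  have hw : (Ty.mu s F).WF := ⟨hF.mu.to_type, hu, hc⟩
  refine ⟨hw, fun h h' => ?_, ?_, ?_⟩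
  · obtain rfl := hs h h'
    exact hF.mu
  · exact (EqMu.contr hA (hσ.wf_subst hw) (by rwa [inst_subst_up])).symm
  · exact (EqMu.contr hB (hτ.wf_subst hw) (by rwa [inst_subst_up])).symm

/-- Induction on the number of reachable pairs not yet assigned to a variable. An assigned pair is
generalized by its variable; any other pair is assigned to a new bound variable before its heads are
treated. -/
theorem exists_common {A₀ B₀ : Ty C} {σ τ : Srt → ℕ → Ty C} (hσ : Env σ) (hτ : Env τ)
    (hvar : ∀ t n, ∃ m, σ t m = .var t n ∧ τ t m = .var t n) {A B : Ty C}
    (hA : A ∈ closure A₀) (hB : B ∈ closure B₀) (hAw : A.WF) (hBw : B.WF) (hAB : Bisim A B) :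
    ∃ E, Common σ τ A B E := by
  classical
  induction hn : {p ∈ closure A₀ ×ˢ closure B₀ | ¬ Assigned σ τ p.1 p.2}.ncard
    using Nat.strong_induction_on generalizing σ τ A B with
  | _ n ih =>
  by_cases has : Assigned σ τ A B
  · obtain ⟨s, m, rfl, rfl, hs⟩ := has
    refine ⟨.var s m, ⟨hasSort_type_var _ _, trivial⟩, fun h h' => ?_, .refl hAw, .refl hBw⟩
    obtain rfl := hs h h'
    exact .var _ _
  -- The new variable is a datatype variable exactly when both expressions are datatypes, so that it
  -- may occur to the left of `app`.
  obtain ⟨s, hsA, hsB, hs, hs'⟩ : ∃ s, HasSort s A ∧ HasSort s B ∧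
      (HasSort .data A → HasSort .data B → s = .data) ∧
      (s = .data → HasSort .data A ∧ HasSort .data B) := by
    by_cases h : HasSort .data A ∧ HasSort .data B
    · exact ⟨.data, h.1, h.2, fun _ _ => rfl, fun _ => h⟩
    · exact ⟨.type, hAw.1, hBw.1, fun h1 h2 => absurd ⟨h1, h2⟩ h, fun h => by cases h⟩
  have hσ' := hσ.cons hsA hAw.2
  have hτ' := hτ.cons hsB hBw.2
  have hvar' : ∀ t n, ∃ m, Ty.cons s A σ t m = .var t n ∧ Ty.cons s B τ t m = .var t n := by
    intro t n
    obtain ⟨m, h1, h2⟩ := hvar t n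
    exact ⟨bump s t m, by rw [cons_bump, h1], by rw [cons_bump, h2]⟩
  -- Extending the environments keeps the old assignments, with indices moved by `bump`, and adds
  -- the pair `A`, `B` at index `0`.
  have hlt : {p ∈ closure A₀ ×ˢ closure B₀ |
      ¬ Assigned (Ty.cons s A σ) (Ty.cons s B τ) p.1 p.2}.ncard < n := by
    rw [← hn]
    refine Set.ncard_lt_ncard ⟨fun p hp => ⟨hp.1, fun h => hp.2 ?_⟩, fun hsub => ?_⟩
      (((finite_closure A₀).prod (finite_closure B₀)).subset fun p hp => hp.1)
    · obtain ⟨t, m, h1, h2, h3⟩ := h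
      exact ⟨t, bump s t m, by rw [cons_bump, h1], by rw [cons_bump, h2], h3⟩
    · have : (A, B) ∈ {p ∈ closure A₀ ×ˢ closure B₀ | ¬ Assigned σ τ p.1 p.2} :=
        ⟨⟨hA, hB⟩, has⟩
      exact (hsub this).2 ⟨s, 0, cons_zero _ _ _, cons_zero _ _ _, hs⟩
  have hfin : {p : Ty C × Ty C | Head A p.1 ∧ Head B p.2 ∧ HeadRel Bisim p.1 p.2}.Finite :=
    ((finite_head A).prod (finite_head B)).subset fun p hp => ⟨hp.1, hp.2.1⟩
  have hmem : ∀ p, p ∈ hfin.toFinset.toList ↔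
      Head A p.1 ∧ Head B p.2 ∧ HeadRel Bisim p.1 p.2 := by simp
  generalize hfin.toFinset.toList = l at hmem
  have hl : l ≠ [] := by
    obtain ⟨h, hh⟩ := exists_head hAw
    obtain ⟨h', h1, h2⟩ := hAB.exists_head hh
    exact List.ne_nil_of_mem ((hmem (h, h')).2 ⟨hh, h1, h2⟩)
  obtain ⟨F, hu, hF, hFs, ⟨h1, h2⟩, ⟨h3, h4⟩⟩ := exists_join hσ' hτ' (s := s) l hl fun p hp => by
    obtain ⟨hp1, hp2, hp⟩ := (hmem p).1 hp
    exact common_of_headRel hσ' hτ' hvar hp (hp1.wf hAw) (hp2.wf hBw)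
      fun hD hD' hw hw' hX => ih _ hlt hσ' hτ' hvar'
        (SubStep.mem_closure (hp1.mem_closure hA) hD)
        (SubStep.mem_closure (hp2.mem_closure hB) hD') hw hw' hX rfl
  refine ⟨.mu s F, common_mu hσ hτ hsA hsB hs ?_ hF.2 hu ?_ ?_⟩
  · cases s with
    | type => exact hF.1
    | data =>
      obtain ⟨h5, h6⟩ := hs' rfl
      exact hFs fun p hp => ⟨((hmem p).1 hp).1.hasSort_data h5, ((hmem p).1 hp).2.1.hasSort_data h6⟩
  -- The first components of the pairs are all the heads of `A`: bisimilarity supplies each with a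
  -- partner. So their join is `A`.
  · refine LeMu.antisymm (.of_forall_head hAw fun x hx => ?_)
      (h2 _ fun p hp => .of_head hAw ((hmem p).1 hp).1)
    obtain ⟨y, hy, hxy⟩ := hAB.exists_head hx
    exact h1 (x, y) ((hmem _).2 ⟨hx, hy, hxy⟩)
  · refine LeMu.antisymm (.of_forall_head hBw fun x hx => ?_)
      (h4 _ fun p hp => .of_head hBw ((hmem p).1 hp).2.1)
    obtain ⟨y, hy, hxy⟩ := hAB.exists_head_right hx
    exact h3 (y, x) ((hmem _).2 ⟨hy, hx, hxy⟩)

/-- Completeness: bisimilar types are equivalent. -/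
theorem eqMu_of_bisim {A B : Ty C} (hA : A.WF) (hB : B.WF) (h : Bisim A B) : EqMu A B := by
  have henv : Env (Ty.var : Srt → ℕ → Ty C) := fun s n => ⟨.var s n, trivial⟩
  -- Under identity substitutions, the generalization is itself equivalent to both types.
  obtain ⟨E, hE⟩ := exists_common henv henv (fun t n => ⟨n, rfl, rfl⟩) (self_mem_closure A)
    (self_mem_closure B) hA hB h
  have h1 := hE.left
  have h2 := hE.right
  rw [subst_var] at h1 h2
  exact h1.symm.trans h2

/-! ## Components of the unfolding -/

namespace BTree

theorem components_of_ne_union {t : BTree C} (h : t.dest.1 ≠ BSym.union) : t.components = [t] := by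
  rw [components]
  split
  · rename_i hg
    exact absurd (by rw [hg]) h
  all_goals rfl

theorem components_union {t : BTree C} {f} (h : t.dest = ⟨BSym.union, f⟩) :
    t.components = components (f (0 : Fin 2)) ++ components (f (1 : Fin 2)) := by
  rw [components]
  split
  · rename_i g hg
    rw [h] at hg
    cases hg
    rfl
  all_goals (rename_i hg; rw [h] at hg; cases hg)

theorem toNTree_eq (t : BTree C) :
    t.toNTree = PFunctor.M.mk ((NSig C).map toNTree (nstep t)) :=
  PFunctor.M.corec_def nstep t

theorem toNTree_atom {t : BTree C} {a f} (h : t.dest = ⟨BSym.atom a, f⟩) :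
    t.toNTree = NTree.atom a := by
  rw [toNTree_eq, nstep]
  split <;> (rename_i hg; rw [h] at hg; cases hg)
  rw [NTree.atom]
  refine congrArg PFunctor.M.mk (Sigma.ext rfl (heq_of_eq ?_))
  funext i
  exact Fin.elim0 i

theorem toNTree_app {t : BTree C} {f} (h : t.dest = ⟨BSym.app, f⟩) :
    t.toNTree = NTree.app (f (0 : Fin 2)).toNTree (f (1 : Fin 2)).toNTree := by
  rw [toNTree_eq, nstep]
  split <;> (rename_i hg; rw [h] at hg; cases hg)
  rw [NTree.app]
  refine congrArg PFunctor.M.mk (Sigma.ext rfl (heq_of_eq ?_))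
  funext i
  change Fin 2 at i
  fin_cases i <;> rfl

theorem toNTree_fn {t : BTree C} {f} (h : t.dest = ⟨BSym.fn, f⟩) :
    t.toNTree = NTree.fn (f (0 : Fin 2)).toNTree (f (1 : Fin 2)).toNTree := by
  rw [toNTree_eq, nstep]
  split <;> (rename_i hg; rw [h] at hg; cases hg)
  rw [NTree.fn]
  refine congrArg PFunctor.M.mk (Sigma.ext rfl (heq_of_eq ?_))
  funext i
  change Fin 2 at i
  fin_cases i <;> rfl

theorem toNTree_union {t : BTree C} {f} (h : t.dest = ⟨BSym.union, f⟩) :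
    t.toNTree = NTree.union (one_lt_components h) fun i => (t.components.get i).toNTree := by
  rw [toNTree_eq, nstep]
  split <;> (rename_i hg; rw [h] at hg; cases hg)
  rfl

end BTree

/-! ### Constructors and components of trees with `n`-ary unions. -/

namespace NTree

theorem atom_injective : Function.Injective (atom : Atom C → NTree C) := fun a b h => by
  have := congrArg Sigma.fst (PFunctor.M.mk_inj h)
  cases this
  rfl

theorem app_inj {D A D' A' : NTree C} (h : app D A = app D' A') : D = D' ∧ A = A' := by
  have := eq_of_heq (Sigma.mk.inj (PFunctor.M.mk_inj h)).2
  exact ⟨congrFun this (0 : Fin 2), congrFun this (1 : Fin 2)⟩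

theorem fn_inj {D A D' A' : NTree C} (h : fn D A = fn D' A') : D = D' ∧ A = A' := by
  have := eq_of_heq (Sigma.mk.inj (PFunctor.M.mk_inj h)).2
  exact ⟨congrFun this (0 : Fin 2), congrFun this (1 : Fin 2)⟩

theorem range_eq_of_union_eq {n m : ℕ} {hn : 1 < n} {hm : 1 < m} {A : Fin n → NTree C}
    {B : Fin m → NTree C} (h : union hn A = union hm B) : Set.range A = Set.range B := by
  obtain ⟨h1, h2⟩ := Sigma.mk.inj (PFunctor.M.mk_inj h)
  cases h1
  rw [eq_of_heq h2]

theorem union_congr {n m : ℕ} {hn : 1 < n} {hm : 1 < m} {A : Fin n → NTree C}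
    {B : Fin m → NTree C} (h : n = m) (hAB : ∀ i, A i = B (Fin.cast h i)) :
    union hn A = union hm B := by
  subst h
  exact congrArg (union hn) (funext hAB)

/-- The root symbol. -/
def root (t : NTree C) : NSym C := t.dest.1

theorem not_isUnion_of_root {t : NTree C} (h : ∀ n hn, t.root ≠ .union n hn) : ¬ t.IsUnion := by
  rintro ⟨n, hn, A, rfl⟩
  exact h n hn rfl

theorem not_isUnion_atom (a : Atom C) : ¬ (atom a).IsUnion :=
  not_isUnion_of_root fun _ _ h => by cases h

theorem not_isUnion_app (D A : NTree C) : ¬ (app D A).IsUnion :=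
  not_isUnion_of_root fun _ _ h => by cases h

theorem not_isUnion_fn (A B : NTree C) : ¬ (fn A B).IsUnion :=
  not_isUnion_of_root fun _ _ h => by cases h

/-- The set of the immediate subtrees of a union; other trees are their own only component. -/
def components (t : NTree C) : Set (NTree C) :=
  {u | (¬ t.IsUnion ∧ u = t) ∨ ∃ n hn, ∃ A : Fin n → NTree C, t = union hn A ∧ u ∈ Set.range A}

theorem components_of_not_isUnion {t : NTree C} (h : ¬ t.IsUnion) : t.components = {t} := by
  ext u
  refine ⟨?_, fun hu => .inl ⟨h, hu⟩⟩
  rintro (⟨-, hu⟩ | ⟨n, hn, A, ht, -⟩)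
  · exact hu
  · exact absurd ⟨n, hn, A, ht⟩ h

theorem components_union {n : ℕ} (hn : 1 < n) (A : Fin n → NTree C) :
    (union hn A).components = Set.range A := by
  ext u
  refine ⟨?_, fun hu => .inr ⟨n, hn, A, rfl, hu⟩⟩
  rintro (⟨h, -⟩ | ⟨m, hm, B, hB, hu⟩)
  · exact absurd ⟨n, hn, A, rfl⟩ h
  · rwa [range_eq_of_union_eq hB]

end NTree

/-! ### Heads of a type and components of its tree. -/

namespace MuType

theorem toBTree_mu {s : Srt} {A : Ty C} (h : (Ty.mu s A).WF) :
    toBTree ⟨.mu s A, h⟩ = toBTree ⟨inst s (.mu s A) A, h.unfold⟩ := by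
  refine Subtype.ext ?_
  change PFunctor.M.corec step _ = PFunctor.M.corec step _
  rw [PFunctor.M.corec_def, PFunctor.M.corec_def, step]

theorem dest_toBTree (A : MuType C) :
    A.toBTree.dest = ⟨(step A).1, fun i => toBTree ((step A).2 i)⟩ := rfl

theorem dest_union {A B : Ty C} (h : (Ty.union A B).WF) :
    (toBTree ⟨.union A B, h⟩).dest = ⟨BSym.union,
      fun i => toBTree ((![⟨A, h.union_left⟩, ⟨B, h.union_right⟩] : Fin 2 → MuType C) i)⟩ := by
  rw [dest_toBTree, step]

/-- The translation of a type to a tree with `n`-ary unions. -/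
def ntree (A : MuType C) : NTree C := A.toBTree.toNTree

theorem ntree_var (s : Srt) (n : ℕ) (h) :
    ntree (⟨.var s n, h⟩ : MuType C) = NTree.atom (.var s n) :=
  BTree.toNTree_atom (by rw [dest_toBTree, step])

theorem ntree_const (c : C) (h) : ntree (⟨.const c, h⟩ : MuType C) = NTree.atom (.const c) :=
  BTree.toNTree_atom (by rw [dest_toBTree, step])

theorem ntree_app {D A : Ty C} (h : (Ty.app D A).WF) : ntree (⟨.app D A, h⟩ : MuType C) =
    NTree.app (ntree ⟨D, h.app_left⟩) (ntree ⟨A, h.app_right⟩) :=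
  BTree.toNTree_app (f := fun i => toBTree
    ((![⟨D, h.app_left⟩, ⟨A, h.app_right⟩] : Fin 2 → MuType C) i)) (by rw [dest_toBTree, step])

theorem ntree_fn {A B : Ty C} (h : (Ty.fn A B).WF) : ntree (⟨.fn A B, h⟩ : MuType C) =
    NTree.fn (ntree ⟨A, h.fn_left⟩) (ntree ⟨B, h.fn_right⟩) :=
  BTree.toNTree_fn (f := fun i => toBTree
    ((![⟨A, h.fn_left⟩, ⟨B, h.fn_right⟩] : Fin 2 → MuType C) i)) (by rw [dest_toBTree, step])

/-- Heads and tree components obey the same recursion through unions and unfoldings, so one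
induction on the height yields both. The last clause records whether the root is a union, which
decides the form of the translated tree. -/
theorem exists_components (A : MuType C) : ∃ l : List (MuType C),
    A.toBTree.components = l.map toBTree ∧ (∀ x : MuType C, Head A.1 x.1 ↔ x ∈ l) ∧
      ((∃ x, l = [x] ∧ A.toBTree = x.toBTree) ∨ ∃ f, A.toBTree.dest = ⟨BSym.union, f⟩) := by
  have self : ∀ A : MuType C, A.toBTree.dest.1 ≠ BSym.union → (∀ x, Head A.1 x ↔ x = A.1) →
      ∃ l : List (MuType C),
      A.toBTree.components = l.map toBTree ∧ (∀ x : MuType C, Head A.1 x.1 ↔ x ∈ l) ∧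
      ((∃ x, l = [x] ∧ A.toBTree = x.toBTree) ∨ ∃ f, A.toBTree.dest = ⟨BSym.union, f⟩) :=
    fun A h1 h2 => ⟨[A], BTree.components_of_ne_union h1,
      fun x => by rw [h2, List.mem_singleton, Subtype.ext_iff], .inl ⟨A, rfl, rfl⟩⟩
  induction hn : A.1.height using Nat.strong_induction_on generalizing A with
  | _ n ih =>
    obtain ⟨A, hA⟩ := A
    cases A with
    | var s n =>
      refine self _ (by rw [dest_toBTree, step]; exact fun h => by cases h) fun x =>
        (HeadRel.var (X := fun _ _ => True) s n).head_iff_left x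
    | const c =>
      refine self _ (by rw [dest_toBTree, step]; exact fun h => by cases h) fun x =>
        (HeadRel.const (X := fun _ _ => True) c).head_iff_left x
    | app D A =>
      refine self _ (by rw [dest_toBTree, step]; exact fun h => by cases h) fun x =>
        (HeadRel.app (X := fun _ _ => True) (D' := D) (A' := A) trivial trivial).head_iff_left x
    | fn D A =>
      refine self _ (by rw [dest_toBTree, step]; exact fun h => by cases h) fun x =>
        (HeadRel.fn (X := fun _ _ => True) (A' := D) (B' := A) trivial trivial).head_iff_left x
    | union A B =>
      simp only [height] at hn
      obtain ⟨l, h1, h2, -⟩ := ih A.height (by omega) ⟨A, hA.union_left⟩ rfl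
      obtain ⟨m, h3, h4, -⟩ := ih B.height (by omega) ⟨B, hA.union_right⟩ rfl
      refine ⟨l ++ m, ?_, fun x => ?_, .inr ⟨_, dest_union hA⟩⟩
      · rw [List.map_append, ← h1, ← h3]
        exact BTree.components_union (dest_union hA)
      · rw [head_union_iff, List.mem_append, ← h2, ← h4]
    | mu s A =>
      simp only [height] at hn
      obtain ⟨l, h1, h2, h3⟩ := ih (inst s (.mu s A) A).height
        (by rw [height_inst hA.2.1]; omega) ⟨_, hA.unfold⟩ rfl
      rw [toBTree_mu]
      exact ⟨l, h1, fun x => head_mu_iff.trans (h2 x), h3⟩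

theorem not_isUnion_ntree {x : MuType C} {A : Ty C} (h : Head A x.1) : ¬ x.ntree.IsUnion := by
  have hx := (h.headRel_self (X := fun _ _ => True) fun _ => trivial)
  obtain ⟨x, hw⟩ := x
  cases hx with
  | var s n => rw [ntree_var]; exact NTree.not_isUnion_atom _
  | const c => rw [ntree_const]; exact NTree.not_isUnion_atom _
  | app => rw [ntree_app]; exact NTree.not_isUnion_app _ _
  | fn => rw [ntree_fn]; exact NTree.not_isUnion_fn _ _

theorem ntree_cases (A : MuType C) : ∃ l : List (MuType C),
    (∀ x : MuType C, Head A.1 x.1 ↔ x ∈ l) ∧ ((∃ x, l = [x] ∧ A.ntree = x.ntree) ∨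
      ∃ hn : 1 < l.length, A.ntree = NTree.union hn fun i => (l.get i).ntree) := by
  obtain ⟨l, h1, h2, h3⟩ := exists_components A
  refine ⟨l, h2, ?_⟩
  rcases h3 with ⟨x, hl, hx⟩ | ⟨f, hf⟩
  · exact .inl ⟨x, hl, congrArg BTree.toNTree hx⟩
  · have hlen : A.toBTree.components.length = l.length := by rw [h1, List.length_map]
    refine .inr ⟨hlen ▸ BTree.one_lt_components hf, ?_⟩
    refine (BTree.toNTree_union hf).trans (NTree.union_congr hlen fun i => ?_)
    simp [h1, ntree]

theorem mem_components_ntree {A : MuType C} {u : NTree C} :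
    u ∈ A.ntree.components ↔ ∃ x : MuType C, Head A.1 x.1 ∧ x.ntree = u := by
  obtain ⟨l, h1, ⟨x, rfl, h2⟩ | ⟨hn, h2⟩⟩ := ntree_cases A
  · rw [h2, NTree.components_of_not_isUnion
      (not_isUnion_ntree ((h1 x).2 (List.mem_singleton_self x)))]
    simp [h1, eq_comm]
  · rw [h2, NTree.components_union]
    simp only [h1, Set.mem_range]
    constructor
    · rintro ⟨i, rfl⟩
      exact ⟨_, l.get_mem i, rfl⟩
    · rintro ⟨x, hx, rfl⟩
      obtain ⟨i, rfl⟩ := List.get_of_mem hx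
      exact ⟨i, rfl⟩

end MuType

open MuType

/-! ## Bisimilarity and the coinductive equivalence of trees -/

/-- The images of bisimilar types. -/
def TreeBisim (t t' : NTree C) : Prop :=
  ∃ A B : MuType C, Bisim A.1 B.1 ∧ A.ntree = t ∧ B.ntree = t'

theorem eqUpStep_of_headRel {x y : MuType C} (h : HeadRel Bisim x.1 y.1) :
    EqUpStep ⊥ TreeBisim x.ntree y.ntree := by
  obtain ⟨x, hx⟩ := x
  obtain ⟨y, hy⟩ := y
  cases h with
  | var s n => rw [ntree_var]; exact .refl _
  | const c => rw [ntree_const]; exact .refl _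
  | app h1 h2 =>
    rw [ntree_app, ntree_app]
    exact .comp (.inl ⟨_, _, h1, rfl, rfl⟩) (.inl ⟨_, _, h2, rfl, rfl⟩)
  | fn h1 h2 =>
    rw [ntree_fn, ntree_fn]
    exact .func (.inl ⟨_, _, h1.symm, rfl, rfl⟩) (.inl ⟨_, _, h2, rfl, rfl⟩)

/-- The coinduction step. Whether each side has a union at the root selects the rule; if neither
does, the matched heads are compared constructor by constructor. -/
theorem treeBisim_le : (TreeBisim : NTree C → NTree C → Prop) ≤ EqUpStep ⊥ TreeBisim := by
  rintro _ _ ⟨A, B, hAB, rfl, rfl⟩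
  obtain ⟨l, hl, hA⟩ := ntree_cases A
  obtain ⟨m, hm, hB⟩ := ntree_cases B
  have hr : ∀ x ∈ l, ∃ y ∈ m, HeadRel Bisim x.1 y.1 := by
    intro x hx
    obtain ⟨y, hy, hxy⟩ := hAB.exists_head ((hl x).2 hx)
    exact ⟨⟨y, hy.wf B.2⟩, (hm _).1 hy, hxy⟩
  have hr' : ∀ y ∈ m, ∃ x ∈ l, HeadRel Bisim x.1 y.1 := by
    intro y hy
    obtain ⟨x, hx, hxy⟩ := hAB.exists_head_right ((hm y).2 hy)
    exact ⟨⟨x, hx.wf A.2⟩, (hl _).1 hx, hxy⟩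
  have hul : ∀ x ∈ l, ¬ x.ntree.IsUnion := fun x hx => not_isUnion_ntree ((hl x).2 hx)
  have hum : ∀ x ∈ m, ¬ x.ntree.IsUnion := fun x hx => not_isUnion_ntree ((hm x).2 hx)
  have hX : ∀ {x y : MuType C}, HeadRel Bisim x.1 y.1 → (TreeBisim ⊔ ⊥) x.ntree y.ntree :=
    fun h => .inl ⟨_, _, h.bisim, rfl, rfl⟩
  rcases hA with ⟨x, rfl, hA⟩ | ⟨hln, hA⟩ <;> rcases hB with ⟨y, rfl, hB⟩ | ⟨hmn, hB⟩ <;>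
    rw [hA, hB]
  · obtain ⟨z, hz, hxz⟩ := hr x (List.mem_singleton_self x)
    cases List.mem_singleton.1 hz
    exact eqUpStep_of_headRel hxz
  · refine .union_r hmn (fun j => ?_) (hul x (List.mem_singleton_self x))
      fun j => hum _ (m.get_mem j)
    obtain ⟨z, hz, hxz⟩ := hr' _ (m.get_mem j)
    cases List.mem_singleton.1 hz
    exact hX hxz
  · refine .union_l hln (fun j => ?_) (fun j => hul _ (l.get_mem j))
      (hum y (List.mem_singleton_self y))
    obtain ⟨z, hz, hxz⟩ := hr _ (l.get_mem j)
    cases List.mem_singleton.1 hz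
    exact hX hxz
  · have hf : ∀ i, ∃ j, HeadRel Bisim (l.get i).1 (m.get j).1 := by
      intro i
      obtain ⟨z, hz, hxz⟩ := hr _ (l.get_mem i)
      obtain ⟨j, rfl⟩ := List.get_of_mem hz
      exact ⟨j, hxz⟩
    have hg : ∀ j, ∃ i, HeadRel Bisim (l.get i).1 (m.get j).1 := by
      intro j
      obtain ⟨z, hz, hxz⟩ := hr' _ (m.get_mem j)
      obtain ⟨i, rfl⟩ := List.get_of_mem hz
      exact ⟨i, hxz⟩
    choose f hf using hf
    choose g hg using hg
    exact .union hln hmn f g (fun i => hX (hf i)) (fun j => hX (hg j))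
      (fun i => hul _ (l.get_mem i)) (fun j => hum _ (m.get_mem j))

theorem EqUp.step {R : NTree C → NTree C → Prop} {t t' : NTree C} (h : EqUp R t t') :
    EqUpStep R (EqUp R) t t' :=
  (OrderHom.map_gfp (⟨EqUpStep R, fun _ _ h => EqUpStep.mono h⟩ :
    (NTree C → NTree C → Prop) →o _)).ge t t' h

theorem eqUp_of_bisim {A B : MuType C} (h : Bisim A.1 B.1) : EqUp ⊥ A.ntree B.ntree :=
  OrderHom.le_gfp (⟨EqUpStep ⊥, fun _ _ h => EqUpStep.mono h⟩ :
    (NTree C → NTree C → Prop) →o _) treeBisim_le _ _ ⟨A, B, h, rfl, rfl⟩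

/-- A uniform reading of all the rules: a tree without a union at the root counts as a union of one
component. -/
theorem EqUp.components {t t' : NTree C} (h : EqUp ⊥ t t') :
    (∀ u ∈ t.components, ∃ v ∈ t'.components, EqUp ⊥ u v) ∧
      ∀ v ∈ t'.components, ∃ u ∈ t.components, EqUp ⊥ u v := by
  have hX : ∀ {u v : NTree C}, (EqUp ⊥ ⊔ ⊥ : NTree C → NTree C → Prop) u v → EqUp ⊥ u v :=
    fun h => h.elim id False.elim
  have single : ¬ t.IsUnion → ¬ t'.IsUnion →
      (∀ u ∈ t.components, ∃ v ∈ t'.components, EqUp ⊥ u v) ∧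
      ∀ v ∈ t'.components, ∃ u ∈ t.components, EqUp ⊥ u v := by
    intro h1 h2
    rw [NTree.components_of_not_isUnion h1, NTree.components_of_not_isUnion h2]
    simpa using h
  cases h.step with
  | refl a => exact single (NTree.not_isUnion_atom a) (NTree.not_isUnion_atom a)
  | comp => exact single (NTree.not_isUnion_app _ _) (NTree.not_isUnion_app _ _)
  | func => exact single (NTree.not_isUnion_fn _ _) (NTree.not_isUnion_fn _ _)
  | union hn hm f g h1 h2 _ _ =>
    simp only [NTree.components_union, Set.forall_mem_range, Set.exists_range_iff]
    exact ⟨fun i => ⟨f i, hX (h1 i)⟩, fun j => ⟨g j, hX (h2 j)⟩⟩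
  | @union_l n hn A B h1 _ h3 =>
    simp only [NTree.components_union, NTree.components_of_not_isUnion h3, Set.forall_mem_range,
      Set.exists_range_iff, Set.mem_singleton_iff, exists_eq_left, forall_eq]
    -- The arity exceeds `1`, so there is a first component to match `B`.
    exact ⟨fun i => hX (h1 i), ⟨⟨0, by omega⟩, hX (h1 _)⟩⟩
  | @union_r n hn A B h1 h2 _ =>
    simp only [NTree.components_union, NTree.components_of_not_isUnion h2, Set.forall_mem_range,
      Set.exists_range_iff, Set.mem_singleton_iff, exists_eq_left, forall_eq]
    exact ⟨⟨⟨0, by omega⟩, hX (h1 _)⟩, fun i => hX (h1 i)⟩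

theorem EqUpStep.cases_of_not_isUnion {X : NTree C → NTree C → Prop} {t t' : NTree C}
    (h : EqUpStep ⊥ X t t') (ht : ¬ t.IsUnion) (ht' : ¬ t'.IsUnion) :
    (∃ a, t = .atom a ∧ t' = .atom a) ∨
      (∃ D A D' A', t = .app D A ∧ t' = .app D' A' ∧ X D D' ∧ X A A') ∨
      ∃ A B A' B', t = .fn A B ∧ t' = .fn A' B' ∧ X A' A ∧ X B B' := by
  have hX : ∀ {u v : NTree C}, (X ⊔ ⊥ : NTree C → NTree C → Prop) u v → X u v :=
    fun h => h.elim id False.elim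
  cases h with
  | refl a => exact .inl ⟨a, rfl, rfl⟩
  | comp h1 h2 => exact .inr (.inl ⟨_, _, _, _, rfl, rfl, hX h1, hX h2⟩)
  | func h1 h2 => exact .inr (.inr ⟨_, _, _, _, rfl, rfl, hX h1, hX h2⟩)
  | union hn => exact absurd ⟨_, hn, _, rfl⟩ ht
  | union_l hn => exact absurd ⟨_, hn, _, rfl⟩ ht
  | union_r hn => exact absurd ⟨_, hn, _, rfl⟩ ht'

/-- The translations of the two types are related, in one of the two directions. -/
def RelTree (X : NTree C → NTree C → Prop) (A B : Ty C) : Prop :=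
  ∃ (hA : A.WF) (hB : B.WF), X (ntree ⟨A, hA⟩) (ntree ⟨B, hB⟩) ∨ X (ntree ⟨B, hB⟩) (ntree ⟨A, hA⟩)

theorem eq_var_or_const_of_ntree {A x : Ty C} (hx : Head A x) {hw : x.WF} {a : Atom C}
    (h : ntree ⟨x, hw⟩ = .atom a) :
    (∃ s n, a = .var s n ∧ x = .var s n) ∨ ∃ c, a = .const c ∧ x = .const c := by
  cases hx.headRel_self (X := fun _ _ => True) fun _ => trivial with
  | var s n => rw [ntree_var] at h; exact .inl ⟨s, n, (NTree.atom_injective h).symm, rfl⟩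
  | const c => rw [ntree_const] at h; exact .inr ⟨c, (NTree.atom_injective h).symm, rfl⟩
  | app => rw [ntree_app] at h; cases congrArg NTree.root h
  | fn => rw [ntree_fn] at h; cases congrArg NTree.root h

theorem eq_app_of_ntree {A x : Ty C} (hx : Head A x) {hw : x.WF} {t u : NTree C}
    (h : ntree ⟨x, hw⟩ = .app t u) :
    ∃ D G, x = .app D G ∧ ∃ hD hG, ntree ⟨D, hD⟩ = t ∧ ntree ⟨G, hG⟩ = u := by
  cases hx.headRel_self (X := fun _ _ => True) fun _ => trivial with
  | var s n => rw [ntree_var] at h; cases congrArg NTree.root h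
  | const c => rw [ntree_const] at h; cases congrArg NTree.root h
  | app => rw [ntree_app] at h; exact ⟨_, _, rfl, _, _, NTree.app_inj h⟩
  | fn => rw [ntree_fn] at h; cases congrArg NTree.root h

theorem eq_fn_of_ntree {A x : Ty C} (hx : Head A x) {hw : x.WF} {t u : NTree C}
    (h : ntree ⟨x, hw⟩ = .fn t u) :
    ∃ D G, x = .fn D G ∧ ∃ hD hG, ntree ⟨D, hD⟩ = t ∧ ntree ⟨G, hG⟩ = u := by
  cases hx.headRel_self (X := fun _ _ => True) fun _ => trivial with
  | var s n => rw [ntree_var] at h; cases congrArg NTree.root h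
  | const c => rw [ntree_const] at h; cases congrArg NTree.root h
  | app => rw [ntree_app] at h; cases congrArg NTree.root h
  | fn => rw [ntree_fn] at h; exact ⟨_, _, rfl, _, _, NTree.fn_inj h⟩

theorem headRel_of_eqUpStep {X : NTree C → NTree C → Prop} {A B x y : Ty C} (hx : Head A x)
    (hy : Head B y) {hxw : x.WF} {hyw : y.WF}
    (h : EqUpStep ⊥ X (ntree ⟨x, hxw⟩) (ntree ⟨y, hyw⟩)) : HeadRel (RelTree X) x y := by
  rcases h.cases_of_not_isUnion (not_isUnion_ntree hx) (not_isUnion_ntree hy) with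
    ⟨a, h1, h2⟩ | ⟨_, _, _, _, h1, h2, h3, h4⟩ | ⟨_, _, _, _, h1, h2, h3, h4⟩
  · rcases eq_var_or_const_of_ntree hx h1 with ⟨s, n, rfl, rfl⟩ | ⟨c, rfl, rfl⟩ <;>
      rcases eq_var_or_const_of_ntree hy h2 with ⟨s', n', ha, rfl⟩ | ⟨c', ha, rfl⟩ <;> cases ha
    · exact .var _ _
    · exact .const _
  · obtain ⟨D, G, rfl, hD, hG, rfl, rfl⟩ := eq_app_of_ntree hx h1
    obtain ⟨D', G', rfl, hD', hG', rfl, rfl⟩ := eq_app_of_ntree hy h2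
    exact .app ⟨hD, hD', .inl h3⟩ ⟨hG, hG', .inl h4⟩
  · obtain ⟨D, G, rfl, hD, hG, rfl, rfl⟩ := eq_fn_of_ntree hx h1
    obtain ⟨D', G', rfl, hD', hG', rfl, rfl⟩ := eq_fn_of_ntree hy h2
    exact .fn ⟨hD, hD', .inr h3⟩ ⟨hG, hG', .inl h4⟩

/-- Induction on the depth: equivalent components are trees of heads, and one rule application
exposes their arguments. -/
theorem approx_of_eqUp : ∀ (k : ℕ) {A B : MuType C}, EqUp ⊥ A.ntree B.ntree → Approx k A.1 B.1
  | 0, _, _, _ => trivial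
  | k + 1, A, B, h => by
    -- The contravariant premise of the rule for `fn` arrives reversed; symmetry of `Approx` absorbs
    -- this, so symmetry of `EqUp` is not needed.
    have hmono : ∀ D D' : Ty C, RelTree (EqUp ⊥) D D' → Approx k D D' := by
      rintro D D' ⟨hD, hD', h | h⟩
      · exact approx_of_eqUp k h
      · exact (approx_of_eqUp k h).symm
    refine ⟨fun x hx => ?_, fun y hy => ?_⟩
    · obtain ⟨_, hv, hxy⟩ := h.components.1 _
        (mem_components_ntree.2 ⟨⟨x, hx.wf A.2⟩, hx, rfl⟩)
      obtain ⟨y, hy, rfl⟩ := mem_components_ntree.1 hv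
      exact ⟨y.1, hy, (headRel_of_eqUpStep hx hy hxy.step).mono hmono⟩
    · obtain ⟨_, hv, hxy⟩ := h.components.2 _
        (mem_components_ntree.2 ⟨⟨y, hy.wf B.2⟩, hy, rfl⟩)
      obtain ⟨x, hx, rfl⟩ := mem_components_ntree.1 hv
      exact ⟨x.1, hx, (headRel_of_eqUpStep hx hy hxy.step).mono hmono⟩

end CAP

theorem mainTheorem5 {C : Type*} (A B : CAP.MuType C) :
    CAP.EqMu A.1 B.1 ↔
      CAP.EqUp ⊥ A.toBTree.toNTree B.toBTree.toNTree :=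
  ⟨fun h => CAP.eqUp_of_bisim h.bisim,
    fun h => CAP.eqMu_of_bisim A.2 B.2 fun k => CAP.approx_of_eqUp k h⟩
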